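/- All Banach spaces are real. For a Banach space $X$, let $\mathrm{Sub}(X)$ be the set of all closed subspaces of $X$ (finite- or infinite-dimensional), $\mathrm{Sub}^\infty(X)$ the set of the infinite-dimensional ones, and $\mathrm{Sub}^{<\infty}(X)$ the set of the finite-dimensional ones. Isomorphisms are linear homeomorphisms, and $Y\sqsubseteq Z$ means that there is an isomorphic embedding of $Y$ into $Z$. *Ergodicity.* $\mathrm{Sub}(X)$ carries the Effros Borel structure, generated by the sets $\{Y : Y\cap U\neq\varnothing\}$, $U\subseteq X$ open. $\mathbf E_0$ is the relation of eventual equality on $\{0,1\}^{\mathbb N}$. $X$ is *ergodic* if it is separable and $\mathbf E_0$ is Borel-reducible to the isomorphism relation on $\mathrm{Sub}(X)$, i.e. there is a Borel map $f:\{0,1\}^{\mathbb N}\to \mathrm{Sub}(X)$ such that $x\,\mathbf E_0\,y$ if and only if $f(x)$ and $f(y)$ are isomorphic. *Tightness.* An FDD of $X$ is a sequence $(F_n)_{n\in\mathbb N}$ of nonzero finite-dimensional subspaces such that every $x\in X$ is uniquely $x=\sum_{n=0}^\infty x_n$ with $x_n\in F_n$ for all $n$. A Banach space $Y$ is *tight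 in* $(F_n)$ if there are nonempty intervals $I_0<I_1<\cdots$ of natural numbers such that for every infinite $A\subseteq\mathbb N$, $Y\not\sqsubseteq[F_n\mid n\notin\bigcup_{i\in A}I_i]$, where $[\,\cdot\,]$ is the closed linear span. For $\mathcal H\subseteq \mathrm{Sub}(X)$, $X$ is *$\mathcal H$-tight* if $X\in\mathcal H$ and $X$ has an FDD in which every $Y\in\mathcal H$ is tight. *D-families.* For $F\in \mathrm{Sub}^{<\infty}(X)$, $Y\in\mathrm{Sub}(X)$ with $F\subseteq Y$, and $\varepsilon>0$, let $[F,Y]_\varepsilon$ be the set of $Z\in\mathrm{Sub}(X)$ for which there are $Z'\in\mathrm{Sub}(X)$ with $F\subseteq Z'\subseteq Y$ and an isomorphism $T:Z'\to Z$ with $\|T-\mathrm{Id}_{Z'}\|<\varepsilon$. The topology on $\mathrm{Sub}(X)$ generated by these sets is the *Ellentuck topology*. A *D-family* of subspaces of $X$ is a set $\mathcal H\subseteq\mathrm{Sub}^\infty(X)$ that is $G_\delta$ in $\mathrm{Sub}(X)$ for the Ellentuck topology and such that $Y\in\mathcal H\Leftrightarrow Y+F\in\mathcal H$ for all $Y\in\mathrm{Sub}^\infty(X)$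 and $F\in\mathrm{Sub}^{<\infty}(X)$. It is *invariant under isomorphism* if $Y\in\mathcal H\Leftrightarrow Z\in\mathcal H$ for all isomorphic $Y,Z\in\mathrm{Sub}^\infty(X)$. *Degrees.* An *approximation pair* is a pair $(E,F)$ of a Banach space $E$ of any (finite or infinite) dimension and a finite-dimensional subspace $F\subseteq E$. A *morphism* $(E,F)\to(E',G)$ is a pair $\varphi=(S,T)$ of bounded operators $S:G\to F$, $T:E\to E'$ with $T(S(g))=g$ for all $g\in G$; its norm is $\|\varphi\|=\|S\|\,\|T\|$ if $G\ne\{0\}$ and $\|\varphi\|=1$ if $G=\{0\}$. A *degree* is a map $d$ from approximation pairs to $\mathbb R_+$ for which there is $K:[1,\infty)\times\mathbb R_+\to\mathbb R_+$, non-decreasing in each variable, with $\lim_{s\to1}K(s,t)=t$ for all $t$, such that $d(E',G)\le K(\|\varphi\|,d(E,F))$ for every morphism $\varphi:(E,F)\to(E',G)$. A Banach space $E$ is *$d$-large* if $\sup_{F\in\mathrm{Sub}^{<\infty}(E)}d(E,F)=\infty$. $X$ is *$d$-tight* if it is $\mathcal H$-tight for the family $\mathcal H$ of the $d$-large closed subspaces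 of $X$. **Theorem.** Let $X$ be a Banach space. 1. If $\mathcal H$ is a D-family of subspaces of $X$ that is invariant under isomorphism, and $X$ is $\mathcal H$-tight, then $X$ is ergodic. 2. If $d$ is a degree and $X$ is $d$-tight, then $X$ is ergodic. -/

import Mathlib

open Filter Topology
open scoped NNReal

universe u

/-! ### Borel reducibility and ergodic spaces -/

/-- `E` Borel-reduces to `F`. -/
def BorelReduces {α β : Type*} [MeasurableSpace α] [MeasurableSpace β]
    (E : Setoid α) (F : Setoid β) : Prop :=
  ∃ f : α → β, Measurable f ∧ ∀ x y : α, E x y ↔ F (f x) (f y)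

/-- The relation of eventual equality on the Cantor space `{0,1}^ℕ`. -/
def EZero : Setoid (ℕ → Bool) where
  r x y := ∃ N : ℕ, ∀ n ≥ N, x n = y n
  iseqv :=
    { refl := fun _ => ⟨0, fun _ _ => rfl⟩
      symm := fun ⟨N, h⟩ => ⟨N, fun n hn => (h n hn).symm⟩
      trans := fun ⟨N, h⟩ ⟨M, k⟩ => ⟨max N M, fun n hn =>
        (h n (le_of_max_le_left hn)).trans (k n (le_of_max_le_right hn))⟩ }

section Ergodic

variable (X : Type u) [NormedAddCommGroup X] [NormedSpace ℝ X]

/-- The set of all closed subspaces of `X`, finite- or infinite-dimensional. -/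
abbrev Subspaces : Type u := ClosedSubmodule ℝ X

/-- The Effros Borel structure: the `σ`-algebra generated by the sets
`{Y | Y ∩ U ≠ ∅}` with `U` open in `X`. -/
instance effrosBorel : MeasurableSpace (Subspaces X) :=
  MeasurableSpace.generateFrom
    {S | ∃ U : Set X, IsOpen U ∧ S = {Y : Subspaces X | ((Y : Set X) ∩ U).Nonempty}}

/-- Linear isomorphism (homeomorphic, not necessarily isometric) between closed subspaces. -/
def isoSetoid : Setoid (Subspaces X) where
  r Y Z := Nonempty (Y.toSubmodule ≃L[ℝ] Z.toSubmodule)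
  iseqv :=
    { refl := fun _ => ⟨ContinuousLinearEquiv.refl ℝ _⟩
      symm := fun ⟨e⟩ => ⟨e.symm⟩
      trans := fun ⟨e⟩ ⟨f⟩ => ⟨e.trans f⟩ }

/-- `X` is separable and eventual equality on the Cantor space Borel-reduces to the isomorphism
relation on the closed subspaces of `X`. -/
def IsErgodicSpace : Prop :=
  TopologicalSpace.SeparableSpace X ∧ BorelReduces EZero (isoSetoid X)

end Ergodic

/-! ### Finite-dimensional decompositions and tightness -/

section FDD

variable {X : Type u} [NormedAddCommGroup X] [NormedSpace ℝ X]

/-- `F` is a finite-dimensional decomposition of the whole space `X`: every `x` is in a unique way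
a (possibly conditionally) convergent series `∑ xₙ` with `xₙ ∈ Fₙ`. -/
structure IsFDD (F : ℕ → Submodule ℝ X) : Prop where
  ne_bot : ∀ n, F n ≠ ⊥
  finiteDimensional : ∀ n, FiniteDimensional ℝ (F n)
  existsUnique_expansion : ∀ x : X, ∃! a : ℕ → X, (∀ n, a n ∈ F n) ∧
    Tendsto (fun N => ∑ n ∈ Finset.range N, a n) atTop (𝓝 x)

/-- `[Fₙ | n ∈ A]`, the closed linear span of the `Fₙ` with `n ∈ A`. -/
def closedSpan (F : ℕ → Submodule ℝ X) (A : Set ℕ) : Subspaces X :=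
  (⨆ n ∈ A, F n).closure

/-- `Y` isomorphically embeds into `Z`: there is a bounded linear map `Y → Z` that is bounded
below. -/
def Embeds (Y Z : Type*) [NormedAddCommGroup Y] [NormedSpace ℝ Y]
    [NormedAddCommGroup Z] [NormedSpace ℝ Z] : Prop :=
  ∃ T : Y →L[ℝ] Z, ∃ c : ℝ, 0 < c ∧ ∀ y, c * ‖y‖ ≤ ‖T y‖

/-- The space `Y` is tight in the sequence `F`. The intervals are `Iᵢ = [a i, b i]`, and
`I₀ < I₁ < ⋯`. -/
def TightIn (Y : Type*) [NormedAddCommGroup Y] [NormedSpace ℝ Y]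
    (F : ℕ → Submodule ℝ X) : Prop :=
  ∃ a b : ℕ → ℕ, (∀ i, a i ≤ b i) ∧ (∀ i, b i < a (i + 1)) ∧
    ∀ A : Set ℕ, A.Infinite →
      ¬ Embeds Y (closedSpan F {n | n ∉ ⋃ i ∈ A, Set.Icc (a i) (b i)}).toSubmodule

/-- The sequence `F` is `H`-tight: every member of `H` is tight in it. -/
def IsTightFDD (H : Set (Subspaces X)) (F : ℕ → Submodule ℝ X) : Prop :=
  ∀ Y ∈ H, TightIn Y.toSubmodule F

variable (X) in
/-- The space `X` is `H`-tight. -/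
def IsTightSpace (H : Set (Subspaces X)) : Prop :=
  (⊤ : Subspaces X) ∈ H ∧ ∃ F : ℕ → Submodule ℝ X, IsFDD F ∧ IsTightFDD H F

end FDD

/-! ### D-families -/

section DFamilies

variable {X : Type u} [NormedAddCommGroup X] [NormedSpace ℝ X]

/-- The set `[F, Y]_ε` of all `Z` for which there are a closed `Z'` with `F ⊆ Z' ⊆ Y` and an
isomorphism `T : Z' → Z` with `‖T - Id‖ < ε`, the norm being that of operators `Z' → X`. -/
def ellentuckBasic (F : Submodule ℝ X) (Y : Subspaces X) (ε : ℝ) : Set (Subspaces X) :=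
  {Z | ∃ Z' : Subspaces X, F ≤ Z'.toSubmodule ∧ Z' ≤ Y ∧
    ∃ T : Z'.toSubmodule ≃L[ℝ] Z.toSubmodule,
      ‖Z.toSubmodule.subtypeL.comp (T : Z'.toSubmodule →L[ℝ] Z.toSubmodule)
        - Z'.toSubmodule.subtypeL‖ < ε}

variable (X) in
/-- The Ellentuck topology on the closed subspaces of `X`. -/
abbrev ellentuckTopology : TopologicalSpace (Subspaces X) :=
  TopologicalSpace.generateFrom
    {S | ∃ (F : Submodule ℝ X) (Y : Subspaces X) (ε : ℝ), FiniteDimensional ℝ F ∧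
      F ≤ Y.toSubmodule ∧ 0 < ε ∧ S = ellentuckBasic F Y ε}

/-- The sum `Y + F` of a closed subspace and a finite-dimensional one; it is closed. -/
def addFin (Y : Subspaces X) (F : Submodule ℝ X) [FiniteDimensional ℝ F] : Subspaces X where
  toSubmodule := Y.toSubmodule ⊔ F
  isClosed' := Submodule.isClosed_sup_finiteDimensional _ _ Y.isClosed

/-- A D-family of subspaces of `X`. -/
structure IsDFamily (H : Set (Subspaces X)) : Prop where
  infinite : ∀ Y ∈ H, ¬ FiniteDimensional ℝ Y.toSubmodule
  add_mem_iff : ∀ Y : Subspaces X, ¬ FiniteDimensional ℝ Y.toSubmodule →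
    ∀ (F : Submodule ℝ X) [FiniteDimensional ℝ F], Y ∈ H ↔ addFin Y F ∈ H
  isGδ : @IsGδ (Subspaces X) (ellentuckTopology X) H

/-- `H` is invariant under isomorphism of infinite-dimensional closed subspaces. -/
def IsoInvariant (H : Set (Subspaces X)) : Prop :=
  ∀ Y Z : Subspaces X, ¬ FiniteDimensional ℝ Y.toSubmodule → ¬ FiniteDimensional ℝ Z.toSubmodule →
    Nonempty (Y.toSubmodule ≃L[ℝ] Z.toSubmodule) → (Y ∈ H ↔ Z ∈ H)

end DFamilies

/-! ### Degrees -/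

/-- An approximation pair: a Banach space (of any dimension) with a finite-dimensional subspace. -/
structure ApproxPair : Type (u + 1) where
  space : Type u
  [normed : NormedAddCommGroup space]
  [normedSpace : NormedSpace ℝ space]
  [complete : CompleteSpace space]
  sub : Submodule ℝ space
  [finDim : FiniteDimensional ℝ sub]

attribute [instance] ApproxPair.normed ApproxPair.normedSpace ApproxPair.complete
  ApproxPair.finDim

/-- A morphism `(X, F) → (Y, G)`: operators `S : G → F` and `T : X → Y` with `T (S g) = g`. -/
structure ApproxPair.Hom (P Q : ApproxPair.{u}) where
  S : Q.sub →L[ℝ] P.sub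
  T : P.space →L[ℝ] Q.space
  comm : ∀ g : Q.sub, T (S g : P.space) = (g : Q.space)

open Classical in
/-- The norm of a morphism: `‖S‖ ‖T‖`, or `1` if `G = {0}`. -/
noncomputable def ApproxPair.Hom.norm {P Q : ApproxPair.{u}} (φ : ApproxPair.Hom P Q) : ℝ :=
  if Q.sub = ⊥ then 1 else ‖φ.S‖ * ‖φ.T‖

/-- `d` is a degree. The control function `K` is only relevant on `[1, ∞) × ℝ₊`. -/
def IsDegree (d : ApproxPair.{u} → ℝ≥0) : Prop :=
  ∃ K : ℝ → ℝ≥0 → ℝ≥0,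
    (∀ t, MonotoneOn (fun s => K s t) (Set.Ici 1)) ∧
    (∀ s, 1 ≤ s → Monotone (K s)) ∧
    (∀ t, Tendsto (fun s => K s t) (𝓝[>] 1) (𝓝 t)) ∧
    ∀ (P Q : ApproxPair.{u}) (φ : ApproxPair.Hom P Q), d Q ≤ K φ.norm (d P)

/-- A Banach space `E` is `d`-large if the values `d (E, F)`, for `F` a finite-dimensional subspace
of `E`, are unbounded. -/
def IsLarge (d : ApproxPair.{u} → ℝ≥0) (E : Type u) [NormedAddCommGroup E] [NormedSpace ℝ E]
    [CompleteSpace E] : Prop :=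
  ∀ M : ℝ≥0, ∃ (F : Submodule ℝ E) (_ : FiniteDimensional ℝ F), M < d ⟨E, F⟩

section Large

variable (X : Type u) [NormedAddCommGroup X] [NormedSpace ℝ X] [CompleteSpace X]

/-- The family of `d`-large closed subspaces of `X`. -/
def largeFamily (d : ApproxPair.{u} → ℝ≥0) : Set (Subspaces X) :=
  {Y | haveI : CompleteSpace Y.toSubmodule := Y.isClosed.completeSpace_coe
    IsLarge d Y.toSubmodule}

/-- `X` is `d`-tight. -/
def IsDegreeTight (d : ApproxPair.{u} → ℝ≥0) : Prop :=
  IsTightSpace X (largeFamily X d)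

end Large

/-! Bases of the spaces of the given FDD are strung together into one sequence `e` with biorthogonal
functionals and dense linear span. A point `A` of the Cantor space is read as a set of indices, and
`spanOn e A` is the closed span of the corresponding vectors. Consider the relation `M` on the
Cantor space of those `(A, B)` for which `spanOn e A` embeds into `spanOn e B`.

This relation is meagre. Spans of cofinitely many `e j` have finite codimension and so lie in the
family. Since the family is Ellentuck-Gδ, it then contains `spanOn e A` for comeagrely many `A`
(`eventually_residual_spanOn_mem`). For such an `A`, tightness makes the section of `M` at `A`
meagre: a generic `B` misses infinitely many of the tightness intervals (`TightIn.isMeagre_embeds`).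
As `M` is analytic (`analyticSet_embeds`), meagre sections imply that `M` itself is meagre, by
Kuratowski–Ulam (`MeasureTheory.AnalyticSet.isMeagre_of_sections`).

A continuous map then sends `EZero`-inequivalent points to pairs outside `M`, whose spans are not
isomorphic. It sends equivalent points to index sets that differ by exchanging finitely many indices
for equally many others (`IsMeagre.exists_continuous_avoiding`), and the spans are isomorphic
through a finite-rank perturbation of the identity (`exists_isomorphism_spanOn`).

For a degree it remains to see that the large subspaces form an Ellentuck-Gδ set
(`isGδ_largeFamily`) and that largeness passes to subspaces of finite codimension
(`mem_largeFamily_of_sup_finiteDimensional`). -/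

/-! ### Baire category: analytic sets and Kuratowski–Ulam. -/

section BaireCategory

/-- The points at which `S` is locally nonmeagre. -/
def nonmeagreCore {Y : Type*} [TopologicalSpace Y] (S : Set Y) : Set Y :=
  {x | ∀ U : Set Y, IsOpen U → x ∈ U → ¬ IsMeagre (S ∩ U)}

theorem nonmeagreCore_subset_closure {Y : Type*} [TopologicalSpace Y] (S : Set Y) :
    nonmeagreCore S ⊆ closure S := by
  intro x hx
  rw [mem_closure_iff]
  intro U hU hxU
  obtain ⟨y, hy⟩ := nonempty_of_not_isMeagre (hx U hU hxU)
  exact ⟨y, hy.2, hy.1⟩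

theorem isClosed_nonmeagreCore {Y : Type*} [TopologicalSpace Y] (S : Set Y) :
    IsClosed (nonmeagreCore S) := by
  rw [← isOpen_compl_iff, isOpen_iff_forall_mem_open]
  intro x hx
  simp only [nonmeagreCore, Set.mem_compl_iff, Set.mem_ofPred_eq, not_forall, not_not] at hx
  obtain ⟨U, hU, hxU, hm⟩ := hx
  exact ⟨U, fun y hy h => h U hU hy hm, hU, hxU⟩

/-- Countably many basic open sets `U` with `S ∩ U` meagre cover the difference. -/
theorem isMeagre_diff_nonmeagreCore {Y : Type*} [TopologicalSpace Y] [SecondCountableTopology Y]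
    (S : Set Y) : IsMeagre (S \ nonmeagreCore S) := by
  have hb := TopologicalSpace.isBasis_countableBasis Y
  have hc := TopologicalSpace.countable_countableBasis Y
  set I : Set (Set Y) := {U ∈ TopologicalSpace.countableBasis Y | IsMeagre (S ∩ U)}
  have hm : IsMeagre (⋃ U ∈ I, S ∩ U) :=
    isMeagre_biUnion (hc.mono fun U hU => hU.1) fun U hU => hU.2
  refine hm.mono ?_
  rintro x ⟨hxS, hx⟩
  simp only [nonmeagreCore, Set.mem_ofPred_eq, not_forall, not_not] at hx
  obtain ⟨U, hU, hxU, hmU⟩ := hx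
  obtain ⟨V, hV, hxV, hVU⟩ := hb.exists_subset_of_mem_open hxU hU
  exact Set.mem_biUnion (show V ∈ I from ⟨hV, hmU.mono (Set.inter_subset_inter_right _ hVU)⟩)
    ⟨hxS, hxV⟩

theorem isMeagre_diff_interior {Y : Type*} [TopologicalSpace Y] {C : Set Y} (hC : IsClosed C) :
    IsMeagre (C \ interior C) := by
  rw [← hC.frontier_eq]
  exact IsNowhereDense.isMeagre
    ((isClosed_frontier.isNowhereDense_iff).2 (interior_frontier hC))

theorem isMeagre_closure_diff {Y : Type*} [TopologicalSpace Y] {O : Set Y} (hO : IsOpen O) :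
    IsMeagre (closure O \ O) := by
  have h : closure O \ O = frontier O := hO.frontier_eq.symm
  rw [h]
  refine IsNowhereDense.isMeagre ((isClosed_frontier.isNowhereDense_iff).2 ?_)
  rw [← frontier_compl]
  exact interior_frontier hO.isClosed_compl

/-- Off the interiors of the cores of the `S n`, each `S n` is meagre, hence so is the union. An
open subset of the core of the union can therefore not avoid these interiors. This is the successor
step of the Souslin scheme for analytic sets. -/
theorem isMeagre_nonmeagreCore_iUnion_diff {Y : Type*} [TopologicalSpace Y]
    [SecondCountableTopology Y] (S : ℕ → Set Y) :
    IsMeagre (nonmeagreCore (⋃ n, S n) \ ⋃ n, nonmeagreCore (S n)) := by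
  set D := nonmeagreCore (⋃ n, S n) with hD
  set O := ⋃ n, interior (nonmeagreCore (S n)) with hO'
  have hO : IsOpen O := isOpen_iUnion fun n => isOpen_interior
  have key : interior D ⊆ closure O := by
    intro x hx
    by_contra hxO
    refine interior_subset hx (interior D ∩ (closure O)ᶜ)
      (isOpen_interior.inter isClosed_closure.isOpen_compl) ⟨hx, hxO⟩ ?_
    have hm : IsMeagre (⋃ n, ((S n \ nonmeagreCore (S n)) ∪
        (nonmeagreCore (S n) \ interior (nonmeagreCore (S n))))) :=
      isMeagre_iUnion fun n => (isMeagre_diff_nonmeagreCore _).union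
        (isMeagre_diff_interior (isClosed_nonmeagreCore _))
    refine hm.mono ?_
    rintro y ⟨hy, -, hyO⟩
    obtain ⟨n, hn⟩ := Set.mem_iUnion.1 hy
    refine Set.mem_iUnion.2 ⟨n, ?_⟩
    have h3 : y ∉ interior (nonmeagreCore (S n)) := fun h =>
      hyO (subset_closure (Set.mem_iUnion.2 ⟨n, h⟩))
    by_cases h : y ∈ nonmeagreCore (S n)
    · exact Or.inr ⟨h, h3⟩
    · exact Or.inl ⟨hn, h⟩
  refine ((isMeagre_diff_interior (isClosed_nonmeagreCore (⋃ n, S n))).union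
    (isMeagre_closure_diff hO)).mono ?_
  rintro x ⟨hx, hxn⟩
  by_cases h : x ∈ interior D
  · exact Or.inr ⟨key h, fun hxO => hxn
      (Set.iUnion_mono (fun n => interior_subset) hxO)⟩
  · exact Or.inl ⟨hx, h⟩

/-- A nonmeagre analytic set is comeagre in some nonempty open set. -/
theorem MeasureTheory.AnalyticSet.exists_isOpen_isMeagre_diff {Y : Type*} [TopologicalSpace Y]
    [SecondCountableTopology Y] [T2Space Y] {A : Set Y} (hA : MeasureTheory.AnalyticSet A)
    (hm : ¬ IsMeagre A) : ∃ U : Set Y, IsOpen U ∧ U.Nonempty ∧ IsMeagre (U \ A) := by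
  rw [MeasureTheory.AnalyticSet] at hA
  rcases hA with rfl | ⟨g, hg, rfl⟩
  · exact absurd IsMeagre.empty hm
  -- A Souslin scheme: images of the cylinders of Baire space, each replaced by its closed core.
  let cyl : List ℕ → Set (ℕ → ℕ) := fun s => {y | ∀ i (h : i < s.length), y i = s[i]}
  let D : List ℕ → Set Y := fun s => nonmeagreCore (g '' cyl s)
  have hcyl : ∀ s, cyl s = ⋃ n, cyl (s ++ [n]) := by
    intro s
    ext y
    simp only [cyl, Set.mem_ofPred_eq, Set.mem_iUnion]
    constructor
    · intro h
      refine ⟨y s.length, fun i hi => ?_⟩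
      rw [List.getElem_append]
      split_ifs with h1
      · exact h i h1
      · have : i = s.length := by simp at hi; omega
        simp [this]
    · rintro ⟨n, h⟩ i hi
      have := h i (by simp; omega)
      rwa [List.getElem_append_left hi] at this
  have hM : IsMeagre (⋃ s : List ℕ, D s \ ⋃ n, D (s ++ [n])) := by
    refine isMeagre_iUnion fun s => ?_
    have := isMeagre_nonmeagreCore_iUnion_diff fun n => g '' cyl (s ++ [n])
    rwa [← Set.image_iUnion, ← hcyl] at this
  have hsub : D [] \ Set.range g ⊆ ⋃ s : List ℕ, D s \ ⋃ n, D (s ++ [n]) := by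
    rintro x ⟨hx, hxA⟩
    by_contra hxM
    -- Off the exceptional meagre set, membership in a core passes to some child, so `x` follows an
    -- infinite branch `y`. Continuity of `g` then forces `x = g y`.
    have step : ∀ s, x ∈ D s → ∃ n, x ∈ D (s ++ [n]) := by
      intro s hs
      by_contra hne
      exact hxM (Set.mem_iUnion.2 ⟨s, hs, fun h => hne (Set.mem_iUnion.1 h)⟩)
    choose! nx hnx using step
    obtain ⟨br, hbr0, hbrs⟩ : ∃ br : ℕ → List ℕ, br 0 = [] ∧ ∀ k, br (k + 1) = br k ++ [nx (br k)] :=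
      ⟨fun k => Nat.rec [] (fun _ s => s ++ [nx s]) k, rfl, fun _ => rfl⟩
    have hbr : ∀ k, x ∈ D (br k) := by
      intro k
      induction k with
      | zero => rwa [hbr0]
      | succ k ih => rw [hbrs]; exact hnx _ ih
    have hlen : ∀ k, (br k).length = k := by
      intro k
      induction k with
      | zero => simp [hbr0]
      | succ k ih => simp [hbrs, ih]
    let y : ℕ → ℕ := fun k => nx (br k)
    have hy : ∀ k, ∀ i (h : i < (br k).length), (br k)[i] = y i := by
      intro k
      induction k with
      | zero => intro i h; simp [hbr0] at h
      | succ k ih =>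
        intro i h
        simp only [hbrs, List.getElem_append]
        split_ifs with h1
        · exact ih i h1
        · have : i = k := by rw [hlen] at h h1; omega
          subst this
          simp [y]
    have hxy : x ≠ g y := fun h => hxA ⟨y, h.symm⟩
    obtain ⟨U, V, hU, hV, hxU, hyV, hUV⟩ := t2_separation hxy
    have hmem : g ⁻¹' V ∈ 𝓝 y := hg.continuousAt (hV.mem_nhds hyV)
    rw [nhds_pi, Filter.mem_pi] at hmem
    obtain ⟨I, hI, t, ht, hsubV⟩ := hmem
    obtain ⟨k, hk⟩ := hI.bddAbove
    have hc : g '' cyl (br (k + 1)) ⊆ V := by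
      rintro _ ⟨z, hz, rfl⟩
      refine hsubV fun i hi => ?_
      have h1 : i < (br (k + 1)).length := by
        rw [hlen]; have := hk hi; omega
      have : z i = y i := (hz i h1).trans (hy _ i h1)
      rw [this]
      exact mem_of_mem_nhds (ht i)
    obtain ⟨z, hzU, hz⟩ := mem_closure_iff.1
      (nonmeagreCore_subset_closure _ (hbr (k + 1))) U hU hxU
    exact Set.disjoint_left.1 hUV hzU (hc hz)
  have hnil : g '' cyl [] = Set.range g := by
    rw [← Set.image_univ]
    congr 1
    ext y
    simp [cyl]
  refine ⟨interior (D []), isOpen_interior, ?_, (hM.mono hsub).mono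
    (Set.sdiff_subset_sdiff_left interior_subset)⟩
  by_contra hne
  rw [Set.not_nonempty_iff_eq_empty] at hne
  refine hm (((isMeagre_diff_nonmeagreCore (Set.range g)).union
    (isMeagre_diff_interior (isClosed_nonmeagreCore (Set.range g)))).mono fun x hx => ?_)
  have hne' : interior (nonmeagreCore (Set.range g)) = ∅ := by rw [← hnil]; exact hne
  by_cases h : x ∈ nonmeagreCore (Set.range g)
  · exact Or.inr ⟨h, by simp [hne']⟩
  · exact Or.inl ⟨hx, h⟩

/-- One half of the Kuratowski–Ulam theorem. -/
theorem eventually_residual_section {Y Z : Type*} [TopologicalSpace Y] [TopologicalSpace Z]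
    [SecondCountableTopology Z] {R : Set (Y × Z)} (hR : R ∈ residual (Y × Z)) :
    ∀ᶠ y in residual Y, {z | (y, z) ∈ R} ∈ residual Z := by
  obtain ⟨S, hSo, hSd, hSc, hSR⟩ := mem_residual_iff.1 hR
  have hb := TopologicalSpace.isBasis_countableBasis Z
  have hc := TopologicalSpace.countable_countableBasis Z
  have key : ∀ t ∈ S, ∀ᶠ y in residual Y, {z | (y, z) ∈ t} ∈ residual Z := by
    intro t ht
    -- The projection of the part of `t` over a basic open `V` is open and dense in `Y`.
    have h1 : ∀ V ∈ TopologicalSpace.countableBasis Z, V.Nonempty →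
        ∀ᶠ y in residual Y, ∃ z ∈ V, (y, z) ∈ t := by
      intro V hV hVne
      have hVo := hb.isOpen hV
      have : {y | ∃ z ∈ V, (y, z) ∈ t} = Prod.fst '' (t ∩ Set.univ ×ˢ V) := by
        ext y; simp [and_comm]
      refine residual_of_dense_open ?_ ?_
      · rw [this]
        exact isOpenMap_fst _ ((hSo t ht).inter (isOpen_univ.prod hVo))
      · rw [dense_iff_inter_open]
        intro W hW hWne
        obtain ⟨⟨y, z⟩, hyz, hyt⟩ := (hSd t ht).inter_open_nonempty (W ×ˢ V) (hW.prod hVo)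
          (hWne.prod hVne)
        exact ⟨y, hyz.1, z, hyz.2, hyt⟩
    have h2 : ∀ᶠ y in residual Y, ∀ V ∈ TopologicalSpace.countableBasis Z, V.Nonempty →
        ∃ z ∈ V, (y, z) ∈ t := by
      rw [eventually_countable_ball hc]
      intro V hV
      by_cases hne : V.Nonempty
      · filter_upwards [h1 V hV hne] with y hy _ using hy
      · exact Eventually.of_forall fun y h => absurd h hne
    filter_upwards [h2] with y hy
    refine residual_of_dense_open ((hSo t ht).preimage (Continuous.prodMk_right y)) ?_
    rw [hb.dense_iff]
    intro V hV hne
    obtain ⟨z, hz, hzt⟩ := hy V hV hne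
    exact ⟨z, hz, hzt⟩
  have h3 : ∀ᶠ y in residual Y, ∀ t ∈ S, {z | (y, z) ∈ t} ∈ residual Z := by
    rw [eventually_countable_ball hSc]
    exact key
  filter_upwards [h3] with y hy
  refine mem_of_superset ((countable_sInter_mem (hSc.image fun t => {z | (y, z) ∈ t})).2 ?_) ?_
  · rintro _ ⟨t, ht, rfl⟩
    exact hy t ht
  · intro z hz
    exact hSR fun t ht => hz _ ⟨t, ht, rfl⟩

/-- An analytic subset of a product is meagre if comeagrely many of its sections are meagre. -/
theorem MeasureTheory.AnalyticSet.isMeagre_of_sections {Y Z : Type*} [TopologicalSpace Y]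
    [TopologicalSpace Z] [SecondCountableTopology Y] [SecondCountableTopology Z] [T2Space Y]
    [T2Space Z] [BaireSpace Y] [BaireSpace Z] {E : Set (Y × Z)}
    (hE : MeasureTheory.AnalyticSet E)
    (hs : ∀ᶠ y in residual Y, IsMeagre {z | (y, z) ∈ E}) : IsMeagre E := by
  by_contra hm
  -- Otherwise `E` is comeagre in an open box `V × W`. A generic `y ∈ V` then has a section that is
  -- meagre and yet comeagre in `W`.
  obtain ⟨U, hU, ⟨⟨y0, z0⟩, h0⟩, hUm⟩ := hE.exists_isOpen_isMeagre_diff hm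
  obtain ⟨V, W, hV, hyV, hW, hzW, hVW⟩ := mem_nhds_prod_iff'.1 (hU.mem_nhds h0)
  have h1 := eventually_residual_section hUm
  have h2 := h1.and hs
  obtain ⟨y, hyV', hy1, hy2⟩ := (dense_of_mem_residual h2).inter_open_nonempty V hV ⟨y0, hyV⟩
  refine not_isMeagre_of_isOpen hW ⟨z0, hzW⟩ ((hy2.union (s := {z | (y, z) ∈ E})
    (t := {z | (y, z) ∈ U \ E}) ?_).mono ?_)
  · exact hy1
  · intro z hz
    by_cases h : (y, z) ∈ E
    · exact Or.inl h
    · exact Or.inr ⟨hVW ⟨hyV', hz⟩, h⟩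

end BaireCategory

/-! ### Combinatorics of the Cantor space. -/

section CantorSpace

theorem isOpen_cylinder (p : ℕ → Bool) (N : ℕ) : IsOpen {α : ℕ → Bool | ∀ i < N, α i = p i} := by
  have : {α : ℕ → Bool | ∀ i < N, α i = p i} = ⋂ i ∈ Finset.range N, {α | α i = p i} := by
    ext; simp
  rw [this]
  refine isOpen_biInter_finset fun i _ => ?_
  exact (isOpen_discrete ({p i} : Set Bool)).preimage
    (continuous_apply i : Continuous fun α : ℕ → Bool => α i)

theorem exists_cylinder_subset {U : Set (ℕ → Bool)} {α : ℕ → Bool} (hU : U ∈ 𝓝 α) :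
    ∃ N, ∀ M ≥ N, {β : ℕ → Bool | ∀ i < M, β i = α i} ⊆ U := by
  rw [nhds_pi, Filter.mem_pi] at hU
  obtain ⟨I, hI, t, ht, hsub⟩ := hU
  obtain ⟨k, hk⟩ := hI.bddAbove
  refine ⟨k + 1, fun M hM β hβ => hsub fun i hi => ?_⟩
  rw [hβ i (by have := hk hi; omega)]
  exact mem_of_mem_nhds (ht i)

/-- The number of `true` values of `α` on `[a, b)`. -/
def countTrue (α : ℕ → Bool) (a b : ℕ) : ℕ := ((Finset.Ico a b).filter fun i => α i = true).card

theorem countTrue_add (α : ℕ → Bool) {a b c : ℕ} (hab : a ≤ b) (hbc : b ≤ c) :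
    countTrue α a c = countTrue α a b + countTrue α b c := by
  rw [countTrue, countTrue, countTrue, ← Finset.card_union_of_disjoint, ← Finset.filter_union,
    Finset.Ico_union_Ico_eq_Ico hab hbc]
  exact Finset.disjoint_filter_filter (Finset.Ico_disjoint_Ico_consecutive a b c)

theorem countTrue_congr {α β : ℕ → Bool} {a b : ℕ} (h : ∀ i, a ≤ i → i < b → α i = β i) :
    countTrue α a b = countTrue β a b := by
  unfold countTrue
  congr 1
  refine Finset.filter_congr fun i hi => ?_
  rw [Finset.mem_Ico] at hi
  rw [h i hi.1 hi.2]

theorem countTrue_const_true {α : ℕ → Bool} {a b : ℕ} (h : ∀ i, a ≤ i → i < b → α i = true) :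
    countTrue α a b = b - a := by
  rw [countTrue, Finset.filter_true_of_mem, Nat.card_Ico]
  intro i hi
  rw [Finset.mem_Ico] at hi
  exact h i hi.1 hi.2

theorem countTrue_const_false {α : ℕ → Bool} {a b : ℕ} (h : ∀ i, a ≤ i → i < b → α i = false) :
    countTrue α a b = 0 := by
  rw [countTrue, Finset.filter_false_of_mem, Finset.card_empty]
  intro i hi
  rw [Finset.mem_Ico] at hi
  simp [h i hi.1 hi.2]

/-- The pairs of prefixes are treated one after another, each time lengthening the two words.
Openness keeps the earlier pairs inside `O`. -/
theorem exists_words_into_dense_open {O : Set ((ℕ → Bool) × (ℕ → Bool))} (hO : IsOpen O)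
    (hd : Dense O) (N : ℕ) (S : Finset ((Fin N → Bool) × (Fin N → Bool))) :
    ∃ N' ≥ N, ∃ v w : ℕ → Bool, ∀ pq ∈ S, ∀ α β : ℕ → Bool,
      (∀ i : Fin N, α i = pq.1 i) → (∀ i : Fin N, β i = pq.2 i) →
      (∀ i, N ≤ i → i < N' → α i = v i) → (∀ i, N ≤ i → i < N' → β i = w i) → (α, β) ∈ O := by
  classical
  induction S using Finset.induction_on with
  | empty => exact ⟨N, le_rfl, fun _ => true, fun _ => true, by simp⟩
  | insert pq S _ ih =>
    obtain ⟨N', hN', v, w, h⟩ := ih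
    -- The new prefix, continued by the word found so far.
    let p' : ℕ → Bool := fun i => if hi : i < N then pq.1 ⟨i, hi⟩ else v i
    let q' : ℕ → Bool := fun i => if hi : i < N then pq.2 ⟨i, hi⟩ else w i
    obtain ⟨⟨a, b⟩, ⟨ha, hb⟩, hab⟩ := hd.inter_open_nonempty
      ({α | ∀ i < N', α i = p' i} ×ˢ {β | ∀ i < N', β i = q' i})
      ((isOpen_cylinder p' N').prod (isOpen_cylinder q' N'))
      ⟨(p', q'), fun _ _ => rfl, fun _ _ => rfl⟩
    replace ha : ∀ i < N', a i = p' i := ha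
    replace hb : ∀ i < N', b i = q' i := hb
    obtain ⟨U, hU, V, hV, hUV⟩ := mem_nhds_prod_iff.1 (hO.mem_nhds hab)
    obtain ⟨M₁, hM₁⟩ := exists_cylinder_subset hU
    obtain ⟨M₂, hM₂⟩ := exists_cylinder_subset hV
    refine ⟨max N' (max M₁ M₂), le_trans hN' (le_max_left _ _), a, b, ?_⟩
    intro rs hrs α β hα hβ hαv hβw
    rcases Finset.mem_insert.1 hrs with rfl | hrs
    · refine hUV ⟨hM₁ (max N' (max M₁ M₂)) (by omega) fun i hi => ?_,
        hM₂ (max N' (max M₁ M₂)) (by omega) fun i hi => ?_⟩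
      · change α i = a i
        by_cases hiN : i < N
        · rw [ha i (by omega)]
          simpa [p', hiN] using hα ⟨i, hiN⟩
        · exact hαv i (by omega) hi
      · change β i = b i
        by_cases hiN : i < N
        · rw [hb i (by omega)]
          simpa [q', hiN] using hβ ⟨i, hiN⟩
        · exact hβw i (by omega) hi
    · refine h rs hrs α β hα hβ (fun i h1 h2 => ?_) (fun i h1 h2 => ?_)
      · rw [hαv i h1 (by omega), ha i h2]
        simp [p', h1]
      · rw [hβw i h1 (by omega), hb i h2]
        simp [q', h1]

theorem exists_balanced_words_into_dense_open {O : Set ((ℕ → Bool) × (ℕ → Bool))} (hO : IsOpen O)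
    (hd : Dense O) (N : ℕ) :
    ∃ N' > N, ∃ v w : ℕ → Bool, countTrue v N N' = countTrue w N N' ∧ ∀ α β : ℕ → Bool,
      (∀ i, N ≤ i → i < N' → α i = v i) → (∀ i, N ≤ i → i < N' → β i = w i) → (α, β) ∈ O := by
  obtain ⟨N₁, hN₁, v, w, h⟩ := exists_words_into_dense_open hO hd N Finset.univ
  set c := countTrue v N N₁
  set d := countTrue w N N₁
  -- Each word is padded with as many `true` values as the other one contains, then with `false`, so
  -- that the counts agree.
  let v' : ℕ → Bool := fun i =>
    if i < N₁ then v i else if i < N₁ + d then true else false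
  let w' : ℕ → Bool := fun i =>
    if i < N₁ then w i else if i < N₁ + c then true else false
  have hcount : ∀ (u : ℕ → Bool) (m M : ℕ), m ≤ M → countTrue (fun i =>
      if i < N₁ then u i else if i < N₁ + m then true else false) N (N₁ + M) =
        countTrue u N N₁ + m := by
    intro u m M hmM
    rw [countTrue_add _ hN₁ (show N₁ ≤ N₁ + M by omega),
      countTrue_add _ (show N₁ ≤ N₁ + m by omega) (show N₁ + m ≤ N₁ + M by omega)]
    rw [countTrue_congr (a := N) (b := N₁) (β := u) fun i _ h2 => by simp [h2],
      countTrue_const_true (a := N₁) (b := N₁ + m) fun i h1 h2 => by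
        simp [show ¬ i < N₁ by omega, h2],
      countTrue_const_false (a := N₁ + m) (b := N₁ + M) fun i h1 _ => by
        simp [show ¬ i < N₁ by omega, show ¬ i < N₁ + m by omega]]
    omega
  refine ⟨N₁ + (c + d + 1), by omega, v', w', ?_, fun α β hα hβ => ?_⟩
  · rw [hcount v d _ (by omega), hcount w c _ (by omega)]
    exact Nat.add_comm c d
  · refine h (fun i => α i, fun i => β i) (Finset.mem_univ _) α β (fun _ => rfl) (fun _ => rfl) ?_ ?_
    · intro i h1 h2
      rw [hα i h1 (by omega)]
      simp [v', h2]
    · intro i h1 h2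
      rw [hβ i h1 (by omega)]
      simp [w', h2]

/-- A meagre relation on the Cantor space can be avoided by a continuous map that sends eventually
equal sequences to sequences that are eventually equal with the same number of `true` values
before, and other pairs to unrelated pairs. -/
theorem IsMeagre.exists_continuous_avoiding {M : Set ((ℕ → Bool) × (ℕ → Bool))} (hM : IsMeagre M) :
    ∃ f : (ℕ → Bool) → (ℕ → Bool), Continuous f ∧
      (∀ x y, EZero x y → ∃ N, (∀ i ≥ N, f x i = f y i) ∧
        countTrue (f x) 0 N = countTrue (f y) 0 N) ∧
      ∀ x y, ¬ EZero x y → (f x, f y) ∉ M := by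
  obtain ⟨t, htM, htG, htd⟩ := mem_residual.1 hM
  obtain ⟨P, hPo, rfl⟩ := isGδ_iff_eq_iInter_nat.1 htG
  -- The sets `Q k` decrease, so membership in `Q k` for infinitely many `k` gives membership in
  -- every `P j`.
  let Q : ℕ → Set ((ℕ → Bool) × (ℕ → Bool)) := fun k =>
    ⋂ j ∈ Finset.range (k + 1), P j
  have hQo : ∀ k, IsOpen (Q k) := fun k => isOpen_biInter_finset fun j _ => hPo j
  have hQd : ∀ k, Dense (Q k) := fun k => htd.mono fun z hz =>
    Set.mem_iInter₂.2 fun j _ => Set.mem_iInter.1 hz j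
  -- Symmetrized, because at a coordinate where `x` and `y` differ either of them may have the value
  -- `true`.
  have hQs : ∀ k, Dense (Q k ∩ Prod.swap ⁻¹' Q k) := fun k =>
    (hQd k).inter_of_isOpen_left ((hQd k).preimage (Homeomorph.prodComm _ _).isOpenMap) (hQo k)
  have step : ∀ k N, ∃ N' > N, ∃ v w : ℕ → Bool, countTrue v N N' = countTrue w N N' ∧
      ∀ α β : ℕ → Bool, (∀ i, N ≤ i → i < N' → α i = v i) →
        (∀ i, N ≤ i → i < N' → β i = w i) → (α, β) ∈ Q k ∧ (β, α) ∈ Q k := fun k N =>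
    exists_balanced_words_into_dense_open
      ((hQo k).inter ((hQo k).preimage continuous_swap)) (hQs k) N
  choose nxt hnxt v w hvw hav using step
  obtain ⟨n, hn0, hns⟩ : ∃ n : ℕ → ℕ, n 0 = 0 ∧ ∀ k, n (k + 1) = nxt k (n k) :=
    ⟨fun k => Nat.rec 0 (fun k m => nxt k m) k, rfl, fun _ => rfl⟩
  have hmono : StrictMono n := strictMono_nat_of_lt_succ fun k => by rw [hns]; exact hnxt _ _
  have hex : ∀ j, ∃ k, j < n (k + 1) := fun j =>
    ⟨j, lt_of_lt_of_le (Nat.lt_succ_self j) (hmono.le_apply)⟩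
  -- The index of the block `[n k, n (k + 1))` that contains `j`.
  let κ : ℕ → ℕ := fun j => Nat.find (hex j)
  have hκ : ∀ k j, n k ≤ j → j < n (k + 1) → κ j = k := by
    intro k j h1 h2
    refine (Nat.find_eq_iff _).2 ⟨h2, fun m hm => ?_⟩
    have := hmono.monotone (show m + 1 ≤ k by omega)
    omega
  have hκge : ∀ k j, n k ≤ j → k ≤ κ j := by
    intro k j h
    refine (Nat.le_find_iff _ _).2 fun m hm => ?_
    have := hmono.monotone (show m + 1 ≤ k by omega)
    omega
  -- The bit `x k` selects which of two balanced words fills block `k`. A difference at `k` puts the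
  -- pair of images into `Q k`, whatever the other blocks are.
  let f : (ℕ → Bool) → (ℕ → Bool) := fun x j =>
    if x (κ j) = true then w (κ j) (n (κ j)) j else v (κ j) (n (κ j)) j
  have hft : ∀ x k, x k = true → ∀ i, n k ≤ i → i < n (k + 1) → f x i = w k (n k) i := by
    intro x k hx i h1 h2
    simp [f, hκ k i h1 h2, hx]
  have hff : ∀ x k, x k = false → ∀ i, n k ≤ i → i < n (k + 1) → f x i = v k (n k) i := by
    intro x k hx i h1 h2
    simp [f, hκ k i h1 h2, hx]
  have hblock : ∀ x k, countTrue (f x) (n k) (n (k + 1)) =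
      countTrue (v k (n k)) (n k) (n (k + 1)) := by
    intro x k
    cases hx : x k with
    | false => exact countTrue_congr (hff x k hx)
    | true =>
      rw [countTrue_congr (hft x k hx), hns]
      exact (hvw k (n k)).symm
  have hcount : ∀ x y k, countTrue (f x) 0 (n k) = countTrue (f y) 0 (n k) := by
    intro x y k
    induction k with
    | zero => simp [hn0, countTrue]
    | succ k ih =>
      have h := hmono.monotone (Nat.le_succ k)
      rw [countTrue_add _ (Nat.zero_le _) h, countTrue_add (f y) (Nat.zero_le _) h, ih,
        hblock, hblock]
  refine ⟨f, ?_, ?_, ?_⟩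
  · refine continuous_pi fun j => ?_
    exact (continuous_of_discreteTopology
      (f := fun b : Bool => if b = true then w (κ j) (n (κ j)) j else v (κ j) (n (κ j)) j)).comp
      (continuous_apply (κ j))
  · rintro x y ⟨K, hK⟩
    refine ⟨n K, fun i hi => ?_, hcount x y K⟩
    simp only [f, hK _ (hκge K i hi)]
  · intro x y hxy hmem
    refine htM (a := (f x, f y)) (Set.mem_iInter.2 fun j => ?_) hmem
    have : ∃ k ≥ j, x k ≠ y k := by
      by_contra hcon
      push Not at hcon
      exact hxy ⟨j, hcon⟩
    obtain ⟨k, hkj, hk⟩ := this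
    have hQ : (f x, f y) ∈ Q k := by
      cases hx : x k with
      | false =>
        have hy : y k = true := by rw [hx] at hk; simpa using hk.symm
        exact (hav k (n k) (f x) (f y) (by rw [← hns]; exact hff x k hx)
          (by rw [← hns]; exact hft y k hy)).1
      | true =>
        have hy : y k = false := by rw [hx] at hk; simpa using hk.symm
        exact (hav k (n k) (f y) (f x) (by rw [← hns]; exact hff y k hy)
          (by rw [← hns]; exact hft x k hx)).2
    exact Set.mem_iInter₂.1 hQ j (Finset.mem_range.2 (by omega))

end CantorSpace

/-! ### Coordinates from a finite-dimensional decomposition. -/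

section FDDCoordinates

variable {X : Type u} [NormedAddCommGroup X] [NormedSpace ℝ X]

/-- Continuity comes from the open mapping theorem. The convergent sequences of partial sums form a
Banach space under the sup norm, and unique expansions say that taking the limit is a bijection onto
`X`. -/
theorem IsFDD.exists_projections [CompleteSpace X] {F : ℕ → Submodule ℝ X} (hF : IsFDD F) :
    ∃ P : ℕ → X →L[ℝ] X, (∀ n x, P n x ∈ F n) ∧ (∀ n, ∀ x ∈ F n, P n x = x) ∧
      ∀ m n, m ≠ n → ∀ x ∈ F n, P m x = 0 := by
  have := hF.finiteDimensional
  let ev : OnePoint ℕ → C(OnePoint ℕ, X) →L[ℝ] X := fun t => ContinuousMap.evalCLM ℝ t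
  -- A convergent sequence is a continuous function on `OnePoint ℕ`. Its value at `N` is the sum of
  -- the terms before `N`, whence the value `0` at `0`.
  let W : Submodule ℝ C(OnePoint ℕ, X) := LinearMap.ker (ev ((0 : ℕ) : OnePoint ℕ)).toLinearMap ⊓
    ⨅ n : ℕ, (F n).comap (ev ((n + 1 : ℕ) : OnePoint ℕ) - ev (n : OnePoint ℕ)).toLinearMap
  have hWc : IsClosed (W : Set C(OnePoint ℕ, X)) := by
    simp only [W, Submodule.coe_inf, Submodule.coe_iInf]
    refine IsClosed.inter (ContinuousLinearMap.isClosed_ker _) (isClosed_iInter fun n => ?_)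
    exact (F n).closed_of_finiteDimensional.preimage (ContinuousLinearMap.continuous _)
  have : CompleteSpace W := hWc.completeSpace_coe
  have hWmem : ∀ s : C(OnePoint ℕ, X), s ∈ W ↔ s ((0 : ℕ) : OnePoint ℕ) = 0 ∧
      ∀ n : ℕ, s ((n + 1 : ℕ) : OnePoint ℕ) - s (n : OnePoint ℕ) ∈ F n := by
    intro s
    simp [W, ev, Submodule.mem_iInf]
  have hsum : ∀ s ∈ W, ∀ N : ℕ, ∑ n ∈ Finset.range N,
      (s ((n + 1 : ℕ) : OnePoint ℕ) - s (n : OnePoint ℕ)) = s (N : OnePoint ℕ) := by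
    intro s hs N
    rw [Finset.sum_range_sub (fun n : ℕ => s (n : OnePoint ℕ)), ((hWmem s).1 hs).1, sub_zero]
  have hlim : ∀ s : C(OnePoint ℕ, X),
      Tendsto (fun N : ℕ => s (N : OnePoint ℕ)) atTop (𝓝 (s OnePoint.infty)) := by
    intro s
    exact OnePoint.continuous_iff_from_nat s |>.1 s.continuous
  have hbuild : ∀ (a : ℕ → X) (x : X), (∀ n, a n ∈ F n) →
      Tendsto (fun N => ∑ n ∈ Finset.range N, a n) atTop (𝓝 x) →
      ∃ s ∈ W, s OnePoint.infty = x ∧ ∀ n : ℕ,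
        s ((n + 1 : ℕ) : OnePoint ℕ) - s (n : OnePoint ℕ) = a n := by
    intro a x ha hx
    let s : C(OnePoint ℕ, X) := OnePoint.continuousMapMkNat
      (fun N => ∑ n ∈ Finset.range N, a n) x hx
    have hsn : ∀ N : ℕ, s (N : OnePoint ℕ) = ∑ n ∈ Finset.range N, a n := fun N => rfl
    have hd : ∀ n : ℕ, s ((n + 1 : ℕ) : OnePoint ℕ) - s (n : OnePoint ℕ) = a n := by
      intro n
      rw [hsn, hsn, Finset.sum_range_succ, add_sub_cancel_left]
    refine ⟨s, (hWmem s).2 ⟨by simp [hsn], fun n => by rw [hd]; exact ha n⟩, rfl, hd⟩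
  let Φ : W →L[ℝ] X := (ev OnePoint.infty).comp W.subtypeL
  have hΦ : ∀ s : W, Φ s = s.1 OnePoint.infty := fun s => rfl
  have huniq : ∀ (s : W) (a : ℕ → X), (∀ n, a n ∈ F n) →
      Tendsto (fun N => ∑ n ∈ Finset.range N, a n) atTop (𝓝 (Φ s)) → ∀ n : ℕ,
        s.1 ((n + 1 : ℕ) : OnePoint ℕ) - s.1 (n : OnePoint ℕ) = a n := by
    intro s a ha hlima n
    refine congrFun ((hF.existsUnique_expansion (Φ s)).unique
      (y₁ := fun n => s.1 ((n + 1 : ℕ) : OnePoint ℕ) - s.1 (n : OnePoint ℕ))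
      ⟨((hWmem s.1).1 s.2).2, ?_⟩ ⟨ha, hlima⟩) n
    simp only [hsum s.1 s.2]
    exact hlim s.1
  have hinj : LinearMap.ker Φ.toLinearMap = ⊥ := by
    rw [LinearMap.ker_eq_bot']
    intro s hs
    have hs' : Φ s = 0 := hs
    have h0 := huniq s (fun _ => 0) (fun n => (F n).zero_mem) (by simp [hs'])
    ext t
    have hn : ∀ N : ℕ, s.1 (N : OnePoint ℕ) = 0 := by
      intro N
      rw [← hsum s.1 s.2 N]
      exact Finset.sum_eq_zero fun n _ => h0 n
    induction t using OnePoint.rec with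
    | infty => exact hs'
    | coe n => exact hn n
  have hsurj : LinearMap.range Φ.toLinearMap = ⊤ := by
    rw [LinearMap.range_eq_top]
    intro x
    obtain ⟨a, ⟨ha, hx⟩, -⟩ := hF.existsUnique_expansion x
    obtain ⟨s, hs, hsx, -⟩ := hbuild a x ha hx
    exact ⟨⟨s, hs⟩, hsx⟩
  let Ψ := ContinuousLinearEquiv.ofBijective Φ hinj hsurj
  let P : ℕ → X →L[ℝ] X := fun n => ((ev ((n + 1 : ℕ) : OnePoint ℕ) - ev (n : OnePoint ℕ)).comp
    W.subtypeL).comp Ψ.symm.toContinuousLinearMap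
  have hP : ∀ n x, P n x = (Ψ.symm x).1 ((n + 1 : ℕ) : OnePoint ℕ) -
    (Ψ.symm x).1 (n : OnePoint ℕ) := fun n x => rfl
  have hsingle : ∀ n, ∀ x ∈ F n, ∀ m, P m x = if m = n then x else 0 := by
    intro n x hx m
    rw [hP]
    refine huniq (Ψ.symm x) (fun m => if m = n then x else 0) ?_ ?_ m
    · intro m
      split_ifs with h
      · rwa [h]
      · exact (F m).zero_mem
    · have e : Φ (Ψ.symm x) = x := Ψ.apply_symm_apply x
      rw [e]
      refine tendsto_const_nhds.congr' ?_
      filter_upwards [eventually_gt_atTop n] with N hN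
      simp [hN]
  refine ⟨P, fun n x => ?_, fun n x hx => by simp [hsingle n x hx], fun m n hmn x hx => by
    simp [hsingle n x hx, hmn]⟩
  exact ((hWmem _).1 (Ψ.symm x).2).2 n

/-- Bases of the spaces of a finite-dimensional decomposition, put together in one sequence `e`. -/
theorem IsFDD.exists_biorthogonal [CompleteSpace X] {F : ℕ → Submodule ℝ X} (hF : IsFDD F) :
    ∃ (e : ℕ → X) (f : ℕ → X →L[ℝ] ℝ) (b : ℕ → ℕ),
      (∀ i j, f i (e j) = if i = j then 1 else 0) ∧ (∀ j, e j ∈ F (b j)) ∧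
      (∀ m, {j | b j = m}.Finite) ∧
      (Submodule.span ℝ (Set.range e)).topologicalClosure = ⊤ := by
  classical
  have := hF.finiteDimensional
  obtain ⟨P, hPmem, hPid, hP0⟩ := hF.exists_projections
  let ι := Σ n, Fin (Module.finrank ℝ (F n))
  have hpos : ∀ n, 0 < Module.finrank ℝ (F n) := fun n => by
    have : Nontrivial (F n) := Submodule.nontrivial_iff_ne_bot.2 (hF.ne_bot n)
    exact Module.finrank_pos
  have hinf : Infinite ι :=
    Infinite.of_injective (fun n => (⟨n, ⟨0, hpos n⟩⟩ : ι)) fun m n h => congrArg Sigma.fst h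
  obtain ⟨hden⟩ := nonempty_denumerable ι
  let φ : ℕ ≃ ι := (Denumerable.eqv ι).symm
  let B := fun n => Module.finBasis ℝ (F n)
  let e' : ι → X := fun k => (B k.1 k.2 : X)
  let f' : ι → X →L[ℝ] ℝ := fun k =>
    (LinearMap.toContinuousLinearMap ((B k.1).coord k.2)).comp ((P k.1).codRestrict (F k.1)
      (hPmem k.1))
  have hfe : ∀ i j, f' i (e' j) = if i = j then 1 else 0 := by
    rintro ⟨m, i⟩ ⟨n, j⟩
    by_cases hmn : m = n
    · subst hmn
      have : (P m).codRestrict (F m) (hPmem m) (B m j : X) = B m j :=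
        Subtype.ext (hPid m _ (B m j).2)
      simp only [f', e', ContinuousLinearMap.comp_apply, this]
      by_cases hij : i = j
      · subst hij
        simp
      · have hne : (⟨m, i⟩ : ι) ≠ ⟨m, j⟩ := fun h => hij (eq_of_heq (Sigma.mk.inj h).2)
        rw [if_neg hne]
        simp [Ne.symm hij]
    · have : (P m).codRestrict (F m) (hPmem m) (B n j : X) = 0 :=
        Subtype.ext (hP0 m n hmn _ (B n j).2)
      simp only [f', e', ContinuousLinearMap.comp_apply, this]
      rw [if_neg fun h => hmn (congrArg Sigma.fst h), map_zero]
  refine ⟨e' ∘ φ, f' ∘ φ, fun j => (φ j).1, fun i j => ?_, fun j => (B (φ j).1 (φ j).2).2,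
    fun m => ?_, ?_⟩
  · simp only [Function.comp_apply, hfe, φ.injective.eq_iff]
  · refine Set.Finite.of_finite_image (f := φ) ?_ φ.injective.injOn
    refine (Set.finite_range fun i : Fin (Module.finrank ℝ (F m)) => (⟨m, i⟩ : ι)).subset ?_
    rintro _ ⟨j, hj, rfl⟩
    obtain rfl : (φ j).1 = m := hj
    exact ⟨(φ j).2, rfl⟩
  · rw [EquivLike.range_comp, eq_top_iff]
    have hle : ∀ n, F n ≤ Submodule.span ℝ (Set.range e') := by
      intro n
      have := congrArg (Submodule.map (F n).subtype) (B n).span_eq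
      rw [Submodule.map_span, Submodule.map_top, Submodule.range_subtype] at this
      rw [← this]
      refine Submodule.span_mono ?_
      rintro _ ⟨_, ⟨i, rfl⟩, rfl⟩
      exact ⟨⟨n, i⟩, rfl⟩
    intro x _
    obtain ⟨a, ⟨ha, hx⟩, -⟩ := hF.existsUnique_expansion x
    exact mem_closure_of_tendsto hx (Eventually.of_forall fun N =>
      Submodule.sum_mem _ fun n _ => hle n (ha n))

end FDDCoordinates

/-! ### Ellentuck neighbourhoods. -/

section Ellentuck

/-- A finite-dimensional subspace can be moved into a given dense subspace by an automorphism
arbitrarily close to the identity. -/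
theorem exists_continuousLinearEquiv_mem_of_dense {E : Type*} [NormedAddCommGroup E]
    [NormedSpace ℝ E] [CompleteSpace E] (L : Submodule ℝ E) [FiniteDimensional ℝ L]
    {V : Submodule ℝ E} (hV : Dense (V : Set E)) {δ : ℝ} (hδ : 0 < δ) :
    ∃ R : E ≃L[ℝ] E, ‖(R : E →L[ℝ] E) - ContinuousLinearMap.id ℝ E‖ < δ ∧ ∀ x ∈ L, R x ∈ V := by
  obtain ⟨p, hp⟩ := Submodule.ClosedComplemented.of_finiteDimensional L
  let b := Module.finBasis ℝ L
  let φ : Fin (Module.finrank ℝ L) → E →L[ℝ] ℝ := fun i =>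
    (LinearMap.toContinuousLinearMap (b.coord i)).comp p
  set C := ∑ i, ‖φ i‖ with hC
  have hC0 : 0 ≤ C := Finset.sum_nonneg fun i _ => norm_nonneg _
  -- Makes the correction `w` below smaller than `δ`, for the estimate, and than `1`, so that `1 +
  -- w` is invertible.
  set η := min δ 1 / (C + 1) with hη
  have hmin : 0 < min δ 1 := lt_min hδ one_pos
  have hη0 : 0 < η := div_pos hmin (by linarith)
  have hv : ∀ i, ∃ v ∈ V, ‖v - (b i : E)‖ < η := by
    intro i
    obtain ⟨v, hv, hd⟩ := Metric.dense_iff.1 hV (b i : E) η hη0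
    exact ⟨v, hd, by simpa [dist_eq_norm] using hv⟩
  choose v hvV hvη using hv
  let w : E →L[ℝ] E := ∑ i, (φ i).smulRight (v i - (b i : E))
  have hw : ‖w‖ < min δ 1 := by
    have h1 : ‖w‖ ≤ C * η := by
      rw [hC, Finset.sum_mul]
      refine norm_sum_le_of_le _ fun i _ => ?_
      rw [ContinuousLinearMap.norm_smulRight_apply]
      exact mul_le_mul_of_nonneg_left (hvη i).le (norm_nonneg _)
    have h2 : (C + 1) * η = min δ 1 := by
      rw [hη]; field_simp
    linarith
  let U : (E →L[ℝ] E)ˣ := Units.oneSub (-w) (by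
    rw [norm_neg]; exact lt_of_lt_of_le hw (min_le_right _ _))
  let R := ContinuousLinearEquiv.unitsEquiv ℝ E U
  have hR : (R : E →L[ℝ] E) = ContinuousLinearMap.id ℝ E + w := by
    ext x
    have : (U : E →L[ℝ] E) = 1 - -w := rfl
    change (U : E →L[ℝ] E) x = _
    rw [this, sub_neg_eq_add]
    rfl
  refine ⟨R, ?_, fun x hx => ?_⟩
  · rw [hR, add_sub_cancel_left]
    exact lt_of_lt_of_le hw (min_le_left _ _)
  · have h1 : R x = x + w x := by
      have := congrArg (fun T : E →L[ℝ] E => T x) hR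
      simpa using this
    have h2 : ∑ i, b.repr ⟨x, hx⟩ i • (b i : E) = x := by
      have := congrArg L.subtype (b.sum_repr ⟨x, hx⟩)
      rw [map_sum] at this
      exact this
    have h3 : ∀ i, φ i x = b.repr ⟨x, hx⟩ i := by
      intro i
      have := hp ⟨x, hx⟩
      simp only at this
      simp [φ, this]
    have h4 : R x = ∑ i, b.repr ⟨x, hx⟩ i • v i := by
      rw [h1]
      simp only [w, _root_.sum_apply, ContinuousLinearMap.smulRight_apply, h3,
        smul_sub, Finset.sum_sub_distrib, h2]
      abel
    rw [h4]
    exact V.sum_mem fun i _ => V.smul_mem _ (hvV i)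

variable {X : Type u} [NormedAddCommGroup X] [NormedSpace ℝ X]

/-- The part of an isomorphism `A ≃ B` that lies over a closed subspace of `B`. -/
theorem exists_continuousLinearEquiv_restrict {A B : Subspaces X}
    (S : A.toSubmodule ≃L[ℝ] B.toSubmodule) {Z : Subspaces X} (hZ : Z ≤ B) :
    ∃ (A' : Subspaces X) (hA : A' ≤ A) (T : A'.toSubmodule ≃L[ℝ] Z.toSubmodule),
      (∀ x : A'.toSubmodule, (T x : X) = S ⟨x, hA x.2⟩) ∧
      ∀ a : A.toSubmodule, (S a : X) ∈ Z → (a : X) ∈ A' := by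
  let A₀ : Submodule ℝ X :=
    (Z.toSubmodule.comap (B.toSubmodule.subtype ∘ₗ S.toLinearMap)).map A.toSubmodule.subtype
  have hA₀ : IsClosed (A₀ : Set X) := by
    have h : IsClosed {a : A.toSubmodule | (S a : X) ∈ (Z : Set X)} :=
      Z.isClosed.preimage (continuous_subtype_val.comp S.continuous)
    exact A.isClosed.isClosedEmbedding_subtypeVal.isClosedMap _ h
  let A' : Subspaces X := ⟨A₀, hA₀⟩
  have hA : A' ≤ A := by
    rintro _ ⟨a, -, rfl⟩
    exact a.2
  have hSZ : ∀ x (hx : x ∈ A'), (S ⟨x, hA hx⟩ : X) ∈ Z := by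
    rintro _ ⟨a, ha, rfl⟩
    exact ha
  have hmem : ∀ a : A.toSubmodule, (S a : X) ∈ Z → (a : X) ∈ A' := fun a ha => ⟨a, ha, rfl⟩
  let f : A'.toSubmodule →L[ℝ] Z.toSubmodule :=
    (B.toSubmodule.subtypeL.comp ((S : A.toSubmodule →L[ℝ] B.toSubmodule).comp
      (A'.toSubmodule.subtypeL.codRestrict A.toSubmodule fun x => hA x.2))).codRestrict
      Z.toSubmodule fun x => hSZ x x.2
  let g : Z.toSubmodule →L[ℝ] A'.toSubmodule :=
    (A.toSubmodule.subtypeL.comp ((S.symm : B.toSubmodule →L[ℝ] A.toSubmodule).comp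
      (Z.toSubmodule.subtypeL.codRestrict B.toSubmodule fun x => hZ x.2))).codRestrict
      A'.toSubmodule fun z => hmem _ (by
        simp)
  refine ⟨A', hA, ContinuousLinearEquiv.equivOfInverse f g (fun x => ?_) (fun z => ?_),
    fun x => rfl, hmem⟩
  · refine Subtype.ext ?_
    have h : ((S.symm (S ⟨x, hA x.2⟩) : A.toSubmodule) : X) = x := by rw [S.symm_apply_apply]
    exact h
  · refine Subtype.ext ?_
    have h : ((S (S.symm ⟨z, hZ z.2⟩) : B.toSubmodule) : X) = z := by rw [S.apply_symm_apply]
    exact h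

/-- Perturb the isomorphism `T` onto `Y` by an automorphism `R` of `Y` that carries the image of `G`
into `V`, and let `D` be the resulting subspace. The preimage under `R ∘ T` of any `Z` between `D`
and `Y` contains `G`. -/
theorem ellentuckBasic_of_between [CompleteSpace X] {G : Submodule ℝ X} [FiniteDimensional ℝ G]
    {W Y : Subspaces X} {ε : ℝ} (hY : Y ∈ ellentuckBasic G W ε) {V : Submodule ℝ X}
    (hV : V.closure = Y) :
    ∃ D : Submodule ℝ X, FiniteDimensional ℝ D ∧ D ≤ V ∧
      ∀ Z : Subspaces X, D ≤ Z.toSubmodule → Z ≤ Y → Z ∈ ellentuckBasic G W ε := by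
  obtain ⟨Z', hGZ, hZW, T, hT⟩ := hY
  have : CompleteSpace Y.toSubmodule := Y.isClosed.completeSpace_coe
  have hVY : V ≤ Y.toSubmodule := by
    rw [← hV]; exact V.le_topologicalClosure
  let L : Submodule ℝ Y.toSubmodule :=
    (G.comap Z'.toSubmodule.subtype).map T.toLinearMap
  have hGfd : FiniteDimensional ℝ (G.comap Z'.toSubmodule.subtype) := by
    refine Module.Finite.of_injective
      ((Z'.toSubmodule.subtype.comp (G.comap Z'.toSubmodule.subtype).subtype).codRestrict G
        fun x => x.2) ?_
    intro x y hxy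
    exact Subtype.ext (Subtype.ext (congrArg G.subtype hxy))
  have hLfd : FiniteDimensional ℝ L := inferInstance
  let V' : Submodule ℝ Y.toSubmodule := V.comap Y.toSubmodule.subtype
  have hV' : Dense (V' : Set Y.toSubmodule) := by
    intro y
    rw [closure_subtype]
    have hy : (y : X) ∈ closure (V : Set X) := by
      have h2 : (y : X) ∈ V.closure := hV.symm ▸ y.2
      exact h2
    refine closure_mono ?_ hy
    intro x hx
    exact ⟨⟨x, hVY hx⟩, hx, rfl⟩
  set T₁ : Z'.toSubmodule →L[ℝ] Y.toSubmodule := (T : Z'.toSubmodule →L[ℝ] Y.toSubmodule)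
  set t := ‖Y.toSubmodule.subtypeL.comp T₁ - Z'.toSubmodule.subtypeL‖ with ht
  -- Composing with `R` adds at most `‖R - id‖ * ‖T₁‖` to the distance `t` from the identity, which
  -- has slack `ε - t`.
  obtain ⟨R, hR, hRL⟩ := exists_continuousLinearEquiv_mem_of_dense L hV'
    (δ := (ε - t) / (‖T₁‖ + 1)) (div_pos (by linarith) (by positivity))
  refine ⟨(L.map R.toLinearMap).map Y.toSubmodule.subtype, inferInstance, ?_, ?_⟩
  · rintro _ ⟨_, ⟨x, hx, rfl⟩, rfl⟩
    exact hRL x hx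
  intro Z hDZ hZY
  obtain ⟨A', hA, T', hT', hmem⟩ := exists_continuousLinearEquiv_restrict (T.trans R) hZY
  refine ⟨A', fun x hx => ?_, hA.trans hZW, T', ?_⟩
  · refine hmem ⟨x, hGZ hx⟩ (hDZ ?_)
    exact ⟨_, ⟨T ⟨x, hGZ hx⟩, ⟨⟨x, hGZ hx⟩, hx, rfl⟩, rfl⟩, rfl⟩
  have hbound : ‖Z.toSubmodule.subtypeL.comp (T' : A'.toSubmodule →L[ℝ] Z.toSubmodule)
      - A'.toSubmodule.subtypeL‖ ≤
      ‖(R : Y.toSubmodule →L[ℝ] Y.toSubmodule) - ContinuousLinearMap.id ℝ _‖ * ‖T₁‖ + t := by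
    refine ContinuousLinearMap.opNorm_le_bound _ (by positivity) fun x => ?_
    set x' : Z'.toSubmodule := ⟨x, hA x.2⟩
    have e : (Z.toSubmodule.subtypeL.comp (T' : A'.toSubmodule →L[ℝ] Z.toSubmodule)
        - A'.toSubmodule.subtypeL) x =
        ((((R : Y.toSubmodule →L[ℝ] Y.toSubmodule) - ContinuousLinearMap.id ℝ Y.toSubmodule) (T₁ x') :
          Y.toSubmodule) : X) + (Y.toSubmodule.subtypeL.comp T₁ - Z'.toSubmodule.subtypeL) x' := by
      have h1 : (T' x : X) = R (T x') := hT' x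
      have h2 : T₁ x' = T x' := rfl
      simp [h1, h2, x']
    rw [e, add_mul]
    refine (norm_add_le _ _).trans (add_le_add ?_ ?_)
    · rw [mul_assoc]
      exact ((R : Y.toSubmodule →L[ℝ] Y.toSubmodule) -
        ContinuousLinearMap.id ℝ Y.toSubmodule).le_opNorm_of_le (T₁.le_opNorm x')
    · exact ContinuousLinearMap.le_opNorm _ x'
  refine lt_of_le_of_lt hbound ?_
  have h0 := norm_nonneg T₁
  have h1 : ((ε - t) / (‖T₁‖ + 1)) * (‖T₁‖ + 1) = ε - t := by field_simp
  have h2 : 0 < (ε - t) / (‖T₁‖ + 1) := div_pos (by linarith) (by positivity)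
  nlinarith [mul_le_mul_of_nonneg_right hR.le h0]

/-- An Ellentuck-open set that contains `Y` contains every closed subspace of `Y` that contains a
suitable finite-dimensional subspace of a given dense subspace of `Y`. -/
theorem exists_finiteDimensional_of_ellentuck_open [CompleteSpace X] {U : Set (Subspaces X)}
    (hU : IsOpen[ellentuckTopology X] U) {Y : Subspaces X} (hY : Y ∈ U) {V : Submodule ℝ X}
    (hV : V.closure = Y) :
    ∃ D : Submodule ℝ X, FiniteDimensional ℝ D ∧ D ≤ V ∧
      ∀ Z : Subspaces X, D ≤ Z.toSubmodule → Z ≤ Y → Z ∈ U := by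
  induction hU with
  | basic s hs =>
    obtain ⟨F, W, ε, hF, -, -, rfl⟩ := hs
    exact ellentuckBasic_of_between hY hV
  | univ => exact ⟨⊥, inferInstance, bot_le, fun _ _ _ => trivial⟩
  | inter s t _ _ ihs iht =>
    obtain ⟨D₁, h₁, hD₁, hs⟩ := ihs hY.1
    obtain ⟨D₂, h₂, hD₂, ht⟩ := iht hY.2
    exact ⟨D₁ ⊔ D₂, inferInstance, sup_le hD₁ hD₂, fun Z hZ hZY =>
      ⟨hs Z (le_sup_left.trans hZ) hZY, ht Z (le_sup_right.trans hZ) hZY⟩⟩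
  | sUnion S _ ih =>
    obtain ⟨s, hs, hYs⟩ := hY
    obtain ⟨D, h, hD, hZ⟩ := ih s hs hYs
    exact ⟨D, h, hD, fun Z h1 h2 => ⟨s, hs, hZ Z h1 h2⟩⟩

end Ellentuck

/-! ### Spans of subsequences and their generic behaviour. -/

section SpanOn

/-- A set is comeagre if every basic open set contains a point of its interior. -/
theorem mem_residual_of_cylinders {S : Set (ℕ → Bool)}
    (h : ∀ (α : ℕ → Bool) (N : ℕ), ∃ β : ℕ → Bool, (∀ i < N, β i = α i) ∧ S ∈ 𝓝 β) :
    S ∈ residual (ℕ → Bool) := by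
  refine mem_of_superset (residual_of_dense_open isOpen_interior ?_) interior_subset
  rw [dense_iff_inter_open]
  rintro W hW ⟨α, hα⟩
  obtain ⟨N, hN⟩ := exists_cylinder_subset (hW.mem_nhds hα)
  obtain ⟨β, hβ, hS⟩ := h α N
  exact ⟨β, hN N le_rfl hβ, mem_interior_iff_mem_nhds.2 hS⟩

variable {X : Type u} [NormedAddCommGroup X] [NormedSpace ℝ X]

/-- The closed linear span of the vectors `e j` with `A j = true`. -/
def spanOn (e : ℕ → X) (A : ℕ → Bool) : Subspaces X :=
  (Submodule.span ℝ (e '' {j | A j = true})).closure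

theorem mem_spanOn {e : ℕ → X} {A : ℕ → Bool} {j : ℕ} (h : A j = true) : e j ∈ spanOn e A :=
  Submodule.le_topologicalClosure _ (Submodule.subset_span ⟨j, h, rfl⟩)

theorem spanOn_le {e : ℕ → X} {A : ℕ → Bool} {Z : Subspaces X} (h : ∀ j, A j = true → e j ∈ Z) :
    spanOn e A ≤ Z := by
  refine Submodule.closure_le.2 (Submodule.span_le.2 ?_)
  rintro _ ⟨j, hj, rfl⟩
  exact h j hj

theorem isOpen_setOf_mem_span (e : ℕ → X) (v : X) :
    IsOpen {A : ℕ → Bool | v ∈ Submodule.span ℝ (e '' {j | A j = true})} := by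
  rw [isOpen_iff_mem_nhds]
  intro A hA
  obtain ⟨c, hc, rfl⟩ := (Finsupp.mem_span_image_iff_linearCombination ℝ).1 hA
  have hopen : IsOpen (⋂ j ∈ c.support, {B : ℕ → Bool | B j = true}) :=
    isOpen_biInter_finset fun j _ => (isOpen_discrete ({true} : Set Bool)).preimage
      (continuous_apply j : Continuous fun α : ℕ → Bool => α j)
  refine mem_of_superset (hopen.mem_nhds (Set.mem_iInter₂.2 fun j hj =>
    (Finsupp.mem_supported ℝ c).1 hc hj)) fun B hB => ?_
  exact (Finsupp.mem_span_image_iff_linearCombination ℝ).2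
    ⟨c, (Finsupp.mem_supported ℝ c).2 fun j hj => Set.mem_iInter₂.1 hB j hj, rfl⟩

theorem isOpen_setOf_le_span (e : ℕ → X) (D : Submodule ℝ X) [FiniteDimensional ℝ D] :
    IsOpen {A : ℕ → Bool | D ≤ Submodule.span ℝ (e '' {j | A j = true})} := by
  obtain ⟨s, hs⟩ := (Submodule.fg_iff_finiteDimensional D).2 ‹_›
  have : {A : ℕ → Bool | D ≤ Submodule.span ℝ (e '' {j | A j = true})} =
      ⋂ v ∈ s, {A : ℕ → Bool | v ∈ Submodule.span ℝ (e '' {j | A j = true})} := by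
    ext A
    simp only [Set.mem_ofPred_eq, Set.mem_iInter, ← hs, Submodule.span_le]
    rfl
  rw [this]
  exact isOpen_biInter_finset fun v _ => isOpen_setOf_mem_span e v

/-- An open set meets the closed span exactly when it meets the linear span, which is an open
condition on `A`. -/
theorem measurable_spanOn (e : ℕ → X) : Measurable (spanOn e) := by
  refine measurable_generateFrom ?_
  rintro _ ⟨U, hU, rfl⟩
  have : spanOn e ⁻¹' {Y : Subspaces X | ((Y : Set X) ∩ U).Nonempty} =
      ⋃ v ∈ U, {A : ℕ → Bool | v ∈ Submodule.span ℝ (e '' {j | A j = true})} := by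
    ext A
    simp only [Set.mem_preimage, Set.mem_ofPred_eq, Set.mem_iUnion]
    constructor
    · rintro ⟨x, hx, hxU⟩
      obtain ⟨v, hvU, hv⟩ := mem_closure_iff.1 hx U hU hxU
      exact ⟨v, hvU, hv⟩
    · rintro ⟨v, hvU, hv⟩
      exact ⟨v, Submodule.le_topologicalClosure _ hv, hvU⟩
  rw [this]
  exact (isOpen_biUnion fun v _ => isOpen_setOf_mem_span e v).measurableSet

/-- If a family of subspaces is `Gδ` for the Ellentuck topology and contains all subspaces of
finite codimension, then it contains comeagrely many of the subspaces spanned by subsequences. -/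
theorem eventually_residual_spanOn_mem [CompleteSpace X] {H : Set (Subspaces X)}
    (hG : @IsGδ (Subspaces X) (ellentuckTopology X) H)
    (hH : ∀ (Y : Subspaces X) (F : Submodule ℝ X) [FiniteDimensional ℝ F], addFin Y F = ⊤ → Y ∈ H)
    {e : ℕ → X} (he : (Submodule.span ℝ (Set.range e)).topologicalClosure = ⊤) :
    ∀ᶠ A in residual (ℕ → Bool), spanOn e A ∈ H := by
  obtain ⟨U, hU, rfl⟩ := (@isGδ_iff_eq_iInter_nat _ (ellentuckTopology X) H).1 hG
  simp only [Set.mem_iInter]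
  rw [eventually_countable_forall]
  intro n
  refine mem_residual_of_cylinders fun α N => ?_
  -- With all later vectors present, the span has finite codimension and hence lies in `H`.
  let β : ℕ → Bool := fun j => if j < N then α j else true
  refine ⟨β, fun i hi => by simp [β, hi], ?_⟩
  have hβ : spanOn e β ∈ U n := by
    let F : Submodule ℝ X := Submodule.span ℝ (e '' (Finset.range N : Set ℕ))
    have : FiniteDimensional ℝ F :=
      FiniteDimensional.span_of_finite ℝ ((Finset.finite_toSet _).image e)
    refine Set.mem_iInter.1 (hH (spanOn e β) F ?_) n
    refine eq_top_iff.2 ?_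
    have h1 : (⊤ : Subspaces X) = (Submodule.span ℝ (Set.range e)).closure := by
      refine ClosedSubmodule.toSubmodule_injective ?_
      exact he.symm
    rw [h1]
    refine Submodule.closure_le.2 (Submodule.span_le.2 ?_)
    rintro _ ⟨j, rfl⟩
    by_cases hj : j < N
    · exact Submodule.mem_sup_right (Submodule.subset_span ⟨j, by simpa using hj, rfl⟩)
    · exact Submodule.mem_sup_left (mem_spanOn (by simp [β, hj]))
  obtain ⟨D, hD, hDβ, hZ⟩ := exists_finiteDimensional_of_ellentuck_open (hU n) hβ rfl
  obtain ⟨M, hM⟩ := exists_cylinder_subset ((isOpen_setOf_le_span e D).mem_nhds hDβ)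
  -- Agreement with `β` below `M` puts `D` into the span of `B`; agreement below `N` keeps that span
  -- inside the one of `β`.
  refine mem_of_superset ((isOpen_cylinder β (max N M)).mem_nhds fun _ _ => rfl) fun B hB => ?_
  refine hZ _ ?_ (spanOn_le fun j hj => mem_spanOn ?_)
  · exact (hM _ (le_max_right N M) hB).trans (Submodule.le_topologicalClosure _)
  · by_cases h : j < N
    · rw [← hB j (lt_of_lt_of_le h (le_max_left _ _)), hj]
    · simp [β, h]

theorem Embeds.mono {Y : Type*} [NormedAddCommGroup Y] [NormedSpace ℝ Y] {Z W : Subspaces X}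
    (h : Embeds Y Z.toSubmodule) (hZW : Z ≤ W) : Embeds Y W.toSubmodule := by
  obtain ⟨T, c, hc, hT⟩ := h
  exact ⟨(Z.toSubmodule.subtypeL.comp T).codRestrict W.toSubmodule fun y => hZW (T y).2, c, hc, hT⟩

/-- A tight space embeds into only meagrely many of the subspaces spanned by subsequences. -/
theorem TightIn.isMeagre_embeds {Y : Type*} [NormedAddCommGroup Y] [NormedSpace ℝ Y]
    {F : ℕ → Submodule ℝ X} (hY : TightIn Y F) {e : ℕ → X} {b : ℕ → ℕ} (he : ∀ j, e j ∈ F (b j))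
    (hb : ∀ m, {j | b j = m}.Finite) :
    IsMeagre {B : ℕ → Bool | Embeds Y (spanOn e B).toSubmodule} := by
  obtain ⟨l, r, hlr, hrl, hnot⟩ := hY
  have hl : StrictMono l := strictMono_nat_of_lt_succ fun i => (hlr i).trans_lt (hrl i)
  -- The `B` that meet every interval from the `k`-th on. Outside the union of these sets,
  -- infinitely many intervals are missed and tightness applies.
  let C : ℕ → Set (ℕ → Bool) := fun k =>
    {B | ∀ i ≥ k, ∃ j, B j = true ∧ b j ∈ Set.Icc (l i) (r i)}
  have hC : ∀ k, IsMeagre (C k) := by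
    intro k
    refine mem_residual_of_cylinders fun α N => ?_
    let β : ℕ → Bool := fun j => if j < N then α j else false
    refine ⟨β, fun i hi => by simp [β, hi], ?_⟩
    obtain ⟨m, hm⟩ : ∃ m, ∀ j < N, b j < m :=
      ⟨(Finset.range N).sup b + 1, fun j hj =>
        Nat.lt_succ_of_le (Finset.le_sup (Finset.mem_range.2 hj))⟩
    -- Since `m ≤ i ≤ l i`, the vectors before `N` lie in spaces before the `i`-th interval. Only
    -- finitely many vectors belong to that interval, so omitting them is an open condition.
    let i := max k m
    have hfin : {j | b j ∈ Set.Icc (l i) (r i)}.Finite :=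
      ((Set.finite_Icc (l i) (r i)).biUnion fun m _ => hb m).subset fun j hj => by
        simpa using hj
    obtain ⟨M, hM⟩ := hfin.bddAbove
    refine mem_of_superset ((isOpen_cylinder β (M + 1)).mem_nhds fun _ _ => rfl) fun B hB hBC => ?_
    obtain ⟨j, hj, hjI⟩ := hBC i (le_max_left k m)
    have hjM : j ≤ M := hM hjI
    by_cases h : j < N
    · have h1 := hm j h
      have h2 : i ≤ l i := hl.le_apply
      have h3 := hjI.1
      have h4 : m ≤ i := le_max_right k m
      omega
    · rw [hB j (by omega)] at hj
      simp [β, h] at hj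
  refine (isMeagre_iUnion hC).mono fun B hB => ?_
  by_contra hBC
  let A : Set ℕ := {i | ∀ j, B j = true → b j ∉ Set.Icc (l i) (r i)}
  have hA : A.Infinite := by
    rw [Set.infinite_iff_exists_gt]
    intro k
    have h : B ∉ C (k + 1) := fun h => hBC (Set.mem_iUnion.2 ⟨_, h⟩)
    simp only [C, Set.mem_ofPred_eq, not_forall, not_exists, not_and] at h
    obtain ⟨i, hi, h⟩ := h
    exact ⟨i, h, by omega⟩
  refine hnot A hA (Embeds.mono hB (spanOn_le fun j hj => ?_))
  refine Submodule.le_topologicalClosure _ ?_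
  refine Submodule.mem_iSup_of_mem (b j) (Submodule.mem_iSup_of_mem ?_ (he j))
  simp only [Set.mem_ofPred_eq, Set.mem_iUnion, not_exists]
  exact fun i hi => hi j hj

/-- Equal counts give a bijection between the two sets of indices below `N`. The functionals `f`
turn it into bounded operators that move finitely many basis vectors and fix the others; on the two
spans they are mutually inverse. -/
theorem exists_isomorphism_spanOn {e : ℕ → X} {f : ℕ → X →L[ℝ] ℝ}
    (hf : ∀ i j, f i (e j) = if i = j then 1 else 0) {A B : ℕ → Bool} {N : ℕ}
    (hAB : ∀ i ≥ N, A i = B i) (hc : countTrue A 0 N = countTrue B 0 N) :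
    Nonempty ((spanOn e A).toSubmodule ≃L[ℝ] (spanOn e B).toSubmodule) := by
  classical
  let a := (Finset.Ico 0 N).filter fun i => A i = true
  let b := (Finset.Ico 0 N).filter fun i => B i = true
  let σ : a ≃ b := Finset.equivOfCardEq hc
  let p : ℕ → ℕ := fun j => if h : j ∈ a then σ ⟨j, h⟩ else j
  let q : ℕ → ℕ := fun j => if h : j ∈ b then σ.symm ⟨j, h⟩ else j
  have ha : ∀ j, j ∈ a ↔ j < N ∧ A j = true := by simp [a]
  have hb : ∀ j, j ∈ b ↔ j < N ∧ B j = true := by simp [b]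
  have hpN : ∀ j ≥ N, p j = j := fun j hj => dif_neg fun h => by
    have := (ha j).1 h; omega
  have hqN : ∀ j ≥ N, q j = j := fun j hj => dif_neg fun h => by
    have := (hb j).1 h; omega
  have hpa : ∀ j (h : j ∈ a), p j = σ ⟨j, h⟩ := fun j h => dif_pos h
  have hqb : ∀ j (h : j ∈ b), q j = σ.symm ⟨j, h⟩ := fun j h => dif_pos h
  have hpB : ∀ j, A j = true → B (p j) = true := by
    intro j hj
    by_cases h : j < N
    · rw [hpa j ((ha j).2 ⟨h, hj⟩)]
      exact ((hb _).1 (σ _).2).2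
    · rw [hpN j (by omega), ← hAB j (by omega), hj]
  have hqA : ∀ j, B j = true → A (q j) = true := by
    intro j hj
    by_cases h : j < N
    · rw [hqb j ((hb j).2 ⟨h, hj⟩)]
      exact ((ha _).1 (σ.symm _).2).2
    · rw [hqN j (by omega), hAB j (by omega), hj]
  have hqp : ∀ j, A j = true → q (p j) = j := by
    intro j hj
    by_cases h : j < N
    · rw [hpa j ((ha j).2 ⟨h, hj⟩), hqb _ (σ _).2]
      simp
    · rw [hpN j (by omega), hqN j (by omega)]
  have hpq : ∀ j, B j = true → p (q j) = j := by
    intro j hj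
    by_cases h : j < N
    · rw [hqb j ((hb j).2 ⟨h, hj⟩), hpa _ (σ.symm _).2]
      simp
    · rw [hqN j (by omega), hpN j (by omega)]
  let op : (ℕ → ℕ) → X →L[ℝ] X := fun p =>
    ContinuousLinearMap.id ℝ X + ∑ j ∈ Finset.range N, (f j).smulRight (e (p j) - e j)
  have hop : ∀ p : ℕ → ℕ, (∀ j ≥ N, p j = j) → ∀ j, op p (e j) = e (p j) := by
    intro p hp j
    simp only [op, _root_.add_apply, ContinuousLinearMap.id_apply, _root_.sum_apply,
      ContinuousLinearMap.smulRight_apply, hf, ite_smul, one_smul, zero_smul,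
      Finset.sum_ite_eq', Finset.mem_range]
    split_ifs with h
    · abel
    · rw [hp j (by omega), add_zero]
  have hmaps : ∀ (p : ℕ → ℕ) (A B : ℕ → Bool), (∀ j ≥ N, p j = j) →
      (∀ j, A j = true → B (p j) = true) → ∀ x ∈ spanOn e A, op p x ∈ spanOn e B := by
    intro p A B hp hAB x hx
    refine spanOn_le (Z := (spanOn e B).comap (op p)) (fun j hj => ?_) hx
    rw [ClosedSubmodule.mem_comap, hop p hp]
    exact mem_spanOn (hAB j hj)
  have hinv : ∀ (p q : ℕ → ℕ) (A : ℕ → Bool), (∀ j ≥ N, p j = j) → (∀ j ≥ N, q j = j) →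
      (∀ j, A j = true → q (p j) = j) → ∀ x ∈ spanOn e A, op q (op p x) = x := by
    intro p q A hp hq hqp x hx
    -- The points where the composite is the identity form a closed subspace, so it suffices to
    -- check the vectors `e j`.
    have := spanOn_le (Z := (⊥ : Subspaces X).comap
      ((op q).comp (op p) - ContinuousLinearMap.id ℝ X)) (e := e) (A := A) (fun j hj => ?_) hx
    · simpa [sub_eq_zero] using this
    · simp [hop p hp, hop q hq, hqp j hj]
  refine ⟨ContinuousLinearEquiv.equivOfInverse
    (((op p).comp (spanOn e A).toSubmodule.subtypeL).codRestrict (spanOn e B).toSubmodule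
      fun x => hmaps p A B hpN hpB x x.2)
    (((op q).comp (spanOn e B).toSubmodule.subtypeL).codRestrict (spanOn e A).toSubmodule
      fun x => hmaps q B A hqN hqA x x.2) (fun x => ?_) (fun x => ?_)⟩
  · exact Subtype.ext (hinv p q A hpN hqN hqp x x.2)
  · exact Subtype.ext (hinv q p B hqN hpN hpq x x.2)

end SpanOn

/-! ### The embedding relation and the criterion for ergodicity. -/

section EmbeddingRelation

variable {X : Type u} [NormedAddCommGroup X] [NormedSpace ℝ X]

/-- The assignment `E c ↦ G c` is well defined and bounded by `h2` and extends by density; `h1`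
bounds it below. -/
theorem embeds_of_denseRange {P Y Z : Type*} [AddCommGroup P] [Module ℝ P]
    [NormedAddCommGroup Y] [NormedSpace ℝ Y] [NormedAddCommGroup Z] [NormedSpace ℝ Z]
    [CompleteSpace Z] {E : P →ₗ[ℝ] Y} {G : P →ₗ[ℝ] Z} (hE : DenseRange E) {k : ℝ} (hk : 0 ≤ k)
    (h1 : ∀ c, ‖E c‖ ≤ k * ‖G c‖) (h2 : ∀ c, ‖G c‖ ≤ k * ‖E c‖) : Embeds Y Z := by
  have hT : ∀ c, G.extendOfNorm E (E c) = G c := LinearMap.extendOfNorm_eq hE ⟨k, h2⟩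
  refine ⟨G.extendOfNorm E, (k + 1)⁻¹, by positivity, fun y => ?_⟩
  have h : ‖y‖ ≤ k * ‖G.extendOfNorm E y‖ := by
    refine hE.induction_on y (isClosed_le continuous_norm ?_) fun c => ?_
    · exact continuous_const.mul (ContinuousLinearMap.continuous _).norm
    · rw [hT]
      exact h1 c
  rw [inv_mul_le_iff₀ (by positivity)]
  nlinarith [norm_nonneg (G.extendOfNorm E y)]

/-- An embedding between spans of subsequences is coded by the images of the spanning vectors. -/
theorem embeds_spanOn_iff [CompleteSpace X] {e : ℕ → X} {A B : ℕ → Bool} :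
    Embeds (spanOn e A).toSubmodule (spanOn e B).toSubmodule ↔
      ∃ (x : ℕ → X) (k : ℕ), (∀ j, A j = true → x j ∈ spanOn e B) ∧
        ∀ c : ℕ →₀ ℝ, (∀ j ∈ c.support, A j = true) →
          ‖Finsupp.linearCombination ℝ e c‖ ≤ k * ‖Finsupp.linearCombination ℝ x c‖ ∧
          ‖Finsupp.linearCombination ℝ x c‖ ≤ k * ‖Finsupp.linearCombination ℝ e c‖ := by
  have hmem : ∀ (x : ℕ → X) (Z : Subspaces X), (∀ j, A j = true → x j ∈ Z) → ∀ c : ℕ →₀ ℝ,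
      (∀ j ∈ c.support, A j = true) → Finsupp.linearCombination ℝ x c ∈ Z := by
    intro x Z hx c hc
    rw [Finsupp.linearCombination_apply]
    exact Z.toSubmodule.sum_mem fun j hj => Z.toSubmodule.smul_mem _ (hx j (hc j hj))
  constructor
  · rintro ⟨T, δ, hδ, hT⟩
    -- The values outside `A` are never used; `0` is a filler.
    let x : ℕ → X := fun j => if h : A j = true then (T ⟨e j, mem_spanOn h⟩ : X) else 0
    have hx : ∀ j (h : A j = true), x j = T ⟨e j, mem_spanOn h⟩ := fun j h => dif_pos h
    obtain ⟨k, hk⟩ := exists_nat_ge (max ‖T‖ δ⁻¹)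
    refine ⟨x, k, fun j hj => by rw [hx j hj]; exact (T _).2, fun c hc => ?_⟩
    set y : (spanOn e A).toSubmodule :=
      ⟨Finsupp.linearCombination ℝ e c, hmem e _ (fun j hj => mem_spanOn hj) c hc⟩ 
    have hTy : (T y : X) = Finsupp.linearCombination ℝ x c := by
      have hsum : ∀ z : ℕ → X, Finsupp.linearCombination ℝ z c =
          ∑ j ∈ c.support.attach, c j • z j := by
        intro z
        rw [Finsupp.linearCombination_apply, Finsupp.sum, ← Finset.sum_attach]
      have h1 : y = ∑ j ∈ c.support.attach, c j • (⟨e j, mem_spanOn (hc j j.2)⟩ :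
          (spanOn e A).toSubmodule) := by
        refine Subtype.ext ?_
        rw [AddSubmonoidClass.coe_finsetSum]
        exact hsum e
      rw [h1, map_sum, AddSubmonoidClass.coe_finsetSum, hsum]
      refine Finset.sum_congr rfl fun j _ => ?_
      rw [map_smul, hx j (hc j j.2)]
      rfl
    have h1 : ‖T y‖ = ‖Finsupp.linearCombination ℝ x c‖ := by rw [← hTy]; rfl
    have h2 : ‖y‖ = ‖Finsupp.linearCombination ℝ e c‖ := rfl
    rw [← h1, ← h2]
    constructor
    · have h3 : ‖y‖ ≤ δ⁻¹ * ‖T y‖ := by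
        rw [inv_mul_eq_div, le_div_iff₀ hδ, mul_comm]
        exact hT y
      exact h3.trans (mul_le_mul_of_nonneg_right ((le_max_right _ _).trans hk) (norm_nonneg _))
    · exact (T.le_opNorm y).trans
        (mul_le_mul_of_nonneg_right ((le_max_left _ _).trans hk) (norm_nonneg _))
  · rintro ⟨x, k, hx, hc⟩
    have : CompleteSpace (spanOn e B).toSubmodule := (spanOn e B).isClosed.completeSpace_coe
    obtain ⟨P, hP⟩ : ∃ P : Submodule ℝ (ℕ →₀ ℝ), ∀ c, c ∈ P ↔ ∀ j ∈ c.support, A j = true :=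
      ⟨Finsupp.supported ℝ ℝ {j | A j = true}, fun c => Finsupp.mem_supported ℝ c⟩
    let E : P →ₗ[ℝ] (spanOn e A).toSubmodule :=
      ((Finsupp.linearCombination ℝ e).comp P.subtype).codRestrict _ fun c =>
        hmem e _ (fun j hj => mem_spanOn hj) c ((hP c.1).1 c.2)
    let G : P →ₗ[ℝ] (spanOn e B).toSubmodule :=
      ((Finsupp.linearCombination ℝ x).comp P.subtype).codRestrict _ fun c =>
        hmem x _ hx c ((hP c.1).1 c.2)
    have hc1 : ∀ c, ‖E c‖ ≤ k * ‖G c‖ := fun c =>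
      (hc c ((hP c.1).1 c.2)).1
    have hc2 : ∀ c, ‖G c‖ ≤ k * ‖E c‖ := fun c =>
      (hc c ((hP c.1).1 c.2)).2
    have hE : DenseRange E := by
      intro y
      rw [closure_subtype]
      have hy : (y : X) ∈ closure (Submodule.span ℝ (e '' {j | A j = true}) : Set X) := y.2
      refine closure_mono ?_ hy
      intro v hv
      obtain ⟨c, hcs, rfl⟩ := (Finsupp.mem_span_image_iff_linearCombination ℝ).1 hv
      exact ⟨E ⟨c, (hP c).2 ((Finsupp.mem_supported ℝ c).1 hcs)⟩, ⟨_, rfl⟩, rfl⟩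
    refine embeds_of_denseRange (P := P) (Y := (spanOn e A).toSubmodule)
      (Z := (spanOn e B).toSubmodule) (E := E) (G := G) (k := k) ?_ ?_ ?_ ?_
    · exact hE
    · exact k.cast_nonneg
    · exact hc1
    · exact hc2

theorem isGδ_setOf_mem_spanOn {T : Type*} [TopologicalSpace T] {e : ℕ → X} {B : T → ℕ → Bool}
    {x : T → X} (hB : Continuous B) (hx : Continuous x) : IsGδ {t | x t ∈ spanOn e (B t)} := by
  have : {t | x t ∈ spanOn e (B t)} = ⋂ m : ℕ, ⋃ v : X,
      {t | v ∈ Submodule.span ℝ (e '' {j | B t j = true})} ∩ {t | dist (x t) v < 1 / (m + 1)} := by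
    ext t
    simp only [Set.mem_ofPred_eq, Set.mem_iInter, Set.mem_iUnion, Set.mem_inter_iff]
    constructor
    · intro h m
      obtain ⟨v, hv, hd⟩ := Metric.mem_closure_iff.1 h (1 / ((m : ℝ) + 1)) (by positivity)
      exact ⟨v, hv, hd⟩
    · intro h
      refine Metric.mem_closure_iff.2 fun ε hε => ?_
      obtain ⟨m, hm⟩ := exists_nat_one_div_lt hε
      obtain ⟨v, hv, hd⟩ := h m
      exact ⟨v, hv, hd.trans hm⟩
  rw [this]
  refine IsGδ.iInter_of_isOpen fun m => isOpen_iUnion fun v => IsOpen.inter ?_ ?_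
  · exact (isOpen_setOf_mem_span e v).preimage hB
  · exact isOpen_lt (hx.dist continuous_const) continuous_const

/-- Projection of a Borel set: the witnesses are the images of the spanning vectors and an integer
constant. Lying in the span is a Gδ condition, the norm inequalities a closed one. -/
theorem analyticSet_embeds [CompleteSpace X] [SecondCountableTopology X] (e : ℕ → X) :
    MeasureTheory.AnalyticSet {p : (ℕ → Bool) × (ℕ → Bool) |
      Embeds (spanOn e p.1).toSubmodule (spanOn e p.2).toSubmodule} := by
  let C : Set (((ℕ → Bool) × (ℕ → Bool)) × (ℕ → X) × ℕ) := {t |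
    (∀ j, t.1.1 j = true → t.2.1 j ∈ spanOn e t.1.2) ∧
      ∀ c : ℕ →₀ ℝ, (∀ j ∈ c.support, t.1.1 j = true) →
        ‖Finsupp.linearCombination ℝ e c‖ ≤ t.2.2 * ‖Finsupp.linearCombination ℝ t.2.1 c‖ ∧
        ‖Finsupp.linearCombination ℝ t.2.1 c‖ ≤ t.2.2 * ‖Finsupp.linearCombination ℝ e c‖}
  have hclopen : ∀ j, IsOpen {t : ((ℕ → Bool) × (ℕ → Bool)) × (ℕ → X) × ℕ | t.1.1 j = true} ∧
      IsClosed {t : ((ℕ → Bool) × (ℕ → Bool)) × (ℕ → X) × ℕ | t.1.1 j = true} := by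
    intro j
    have hcont : Continuous fun t : ((ℕ → Bool) × (ℕ → Bool)) × (ℕ → X) × ℕ => t.1.1 j := by
      fun_prop
    exact ⟨(isOpen_discrete ({true} : Set Bool)).preimage hcont,
      (isClosed_discrete ({true} : Set Bool)).preimage hcont⟩
  have hG : IsGδ {t : ((ℕ → Bool) × (ℕ → Bool)) × (ℕ → X) × ℕ |
      ∀ j, t.1.1 j = true → t.2.1 j ∈ spanOn e t.1.2} := by
    simp only [Set.ofPred_forall, imp_iff_not_or]
    refine IsGδ.iInter fun j => ?_
    rw [Set.ofPred_or]
    exact ((hclopen j).2.isOpen_compl.isGδ).union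
      (isGδ_setOf_mem_spanOn (by fun_prop) (by fun_prop))
  have hcl : IsClosed {t : ((ℕ → Bool) × (ℕ → Bool)) × (ℕ → X) × ℕ |
      ∀ c : ℕ →₀ ℝ, (∀ j ∈ c.support, t.1.1 j = true) →
        ‖Finsupp.linearCombination ℝ e c‖ ≤ t.2.2 * ‖Finsupp.linearCombination ℝ t.2.1 c‖ ∧
        ‖Finsupp.linearCombination ℝ t.2.1 c‖ ≤ t.2.2 * ‖Finsupp.linearCombination ℝ e c‖} := by
    rw [Set.ofPred_forall]
    refine isClosed_iInter fun c => ?_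
    have hc : IsOpen {t : ((ℕ → Bool) × (ℕ → Bool)) × (ℕ → X) × ℕ |
        ∀ j ∈ c.support, t.1.1 j = true} := by
      have : {t : ((ℕ → Bool) × (ℕ → Bool)) × (ℕ → X) × ℕ | ∀ j ∈ c.support, t.1.1 j = true} =
          ⋂ j ∈ c.support, {t | t.1.1 j = true} := by
        ext; simp
      rw [this]
      exact isOpen_biInter_finset fun j _ => (hclopen j).1
    have hx : Continuous fun t : ((ℕ → Bool) × (ℕ → Bool)) × (ℕ → X) × ℕ =>
        ‖Finsupp.linearCombination ℝ t.2.1 c‖ := by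
      simp only [Finsupp.linearCombination_apply, Finsupp.sum]
      fun_prop
    have hk : Continuous fun t : ((ℕ → Bool) × (ℕ → Bool)) × (ℕ → X) × ℕ => (t.2.2 : ℝ) :=
      continuous_of_discreteTopology.comp (continuous_snd.comp continuous_snd)
    refine isClosed_imp hc ?_
    exact (isClosed_le continuous_const (hk.mul hx)).inter
      (isClosed_le hx (hk.mul continuous_const))
  have hC : MeasureTheory.AnalyticSet C := by
    have : TopologicalSpace.IsCompletelyMetrizableSpace (ℕ → Bool) := inferInstance
    have : PolishSpace (ℕ → Bool) := inferInstance
    borelize (((ℕ → Bool) × (ℕ → Bool)) × (ℕ → X) × ℕ)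
    exact (hG.measurableSet.inter hcl.measurableSet).analyticSet
  convert hC.image_of_continuous continuous_fst using 1
  ext ⟨A, B⟩
  rw [Set.mem_ofPred_eq, embeds_spanOn_iff]
  constructor
  · rintro ⟨x, k, h⟩
    exact ⟨((A, B), x, k), h, rfl⟩
  · rintro ⟨⟨p, x, k⟩, h, rfl⟩
    exact ⟨x, k, h⟩

theorem ContinuousLinearEquiv.embeds {Y Z : Type*} [NormedAddCommGroup Y] [NormedSpace ℝ Y]
    [NormedAddCommGroup Z] [NormedSpace ℝ Z] (T : Y ≃L[ℝ] Z) : Embeds Y Z := by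
  refine ⟨T, (‖(T.symm : Z →L[ℝ] Y)‖ + 1)⁻¹, by positivity, fun y => ?_⟩
  rw [inv_mul_le_iff₀ (by positivity)]
  have h := (T.symm : Z →L[ℝ] Y).le_opNorm (T y)
  have h1 : (T.symm : Z →L[ℝ] Y) (T y) = y := T.symm_apply_apply y
  rw [h1] at h
  exact h.trans (mul_le_mul_of_nonneg_right (by linarith) (norm_nonneg _))

/-- The common core of both statements: of the family, only the Gδ property, the membership of
finite-codimensional subspaces and tightness enter. -/
theorem isErgodicSpace_of_isGδ [CompleteSpace X] {H : Set (Subspaces X)}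
    (hG : @IsGδ (Subspaces X) (ellentuckTopology X) H)
    (hH : ∀ (Y : Subspaces X) (F : Submodule ℝ X) [FiniteDimensional ℝ F], addFin Y F = ⊤ → Y ∈ H)
    (ht : IsTightSpace X H) : IsErgodicSpace X := by
  obtain ⟨-, F, hF, htF⟩ := ht
  obtain ⟨e, f, b, hfe, heF, hb, he⟩ := hF.exists_biorthogonal
  have hsep : TopologicalSpace.SeparableSpace X := by
    have h1 := (Set.countable_range e).isSeparable.span (R := ℝ)
    have h2 := h1.closure
    rw [← Submodule.topologicalClosure_coe, he] at h2
    exact TopologicalSpace.isSeparable_univ_iff.1 h2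
  have : SecondCountableTopology X := UniformSpace.secondCountable_of_separable X
  -- For generic `A` the span lies in `H`, hence is tight and embeds into only meagrely many spans.
  have hM := (analyticSet_embeds e).isMeagre_of_sections
    ((eventually_residual_spanOn_mem hG hH he).mono fun A hA =>
      (htF _ hA).isMeagre_embeds heF hb)
  obtain ⟨φ, hφ, hφE, hφM⟩ := hM.exists_continuous_avoiding
  refine ⟨hsep, fun x => spanOn e (φ x), (measurable_spanOn e).comp hφ.measurable, fun x y => ?_⟩
  constructor
  · intro h
    obtain ⟨N, h1, h2⟩ := hφE x y h
    exact exists_isomorphism_spanOn hfe h1 h2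
  · rintro ⟨T⟩
    by_contra h
    exact hφM x y h T.embeds

end EmbeddingRelation

/-! ### Functionals vanishing on a subspace. -/

section FunctionalsOnQuotients

variable {E : Type*} [NormedAddCommGroup E] [NormedSpace ℝ E]

theorem exists_functional_eq_one {S : Submodule ℝ E} (hS : IsClosed (S : Set E)) {x : E}
    (hx : x ∉ S) : ∃ f : E →L[ℝ] ℝ, (∀ y ∈ S, f y = 0) ∧ f x = 1 := by
  have : IsClosed (S : Set E) := hS
  have hne : S.mkQ x ≠ 0 := by
    rwa [Submodule.mkQ_apply, Ne, Submodule.Quotient.mk_eq_zero]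
  obtain ⟨g, hg⟩ := SeparatingDual.exists_eq_one (R := ℝ) hne
  refine ⟨g.comp S.mkQL, fun y hy => ?_, hg⟩
  have : S.mkQL y = 0 := (Submodule.Quotient.mk_eq_zero S).2 hy
  rw [ContinuousLinearMap.comp_apply, this, map_zero]

theorem exists_functional_vanishing_on_finiteDimensional (hE : ¬ FiniteDimensional ℝ E)
    (G : Submodule ℝ E) [FiniteDimensional ℝ G] :
    ∃ (g : E →L[ℝ] ℝ) (z : E), ‖g‖ ≤ 1 ∧ ‖z‖ ≤ 2 ∧ g z = 1 ∧ ∀ y ∈ G, g y = 0 := by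
  have hG : ∃ v, v ∉ G := by
    by_contra h
    push Not at h
    have hT : G = ⊤ := eq_top_iff.2 fun v _ => h v
    exact hE (Module.finite_def.2 (hT ▸ (Submodule.fg_iff_finiteDimensional G).2 ‹_›))
  obtain ⟨v, hv⟩ := hG
  obtain ⟨f, hf, hfv⟩ := exists_functional_eq_one G.closed_of_finiteDimensional hv
  have hf0 : 0 < ‖f‖ := norm_pos_iff.2 fun h => by simp [h] at hfv
  -- A vector at which `f` attains more than half its norm; this is the source of the bound `2` on
  -- `z`.
  obtain ⟨x, hx, hfx⟩ := f.exists_lt_apply_of_lt_opNorm (half_lt_self hf0)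
  have hfx0 : 0 < ‖f x‖ := (half_pos hf0).trans hfx
  refine ⟨‖f‖⁻¹ • f, (‖f‖ / f x) • x, ?_, ?_, ?_, fun y hy => by simp [hf y hy]⟩
  · rw [norm_smul, norm_inv, norm_norm, inv_mul_cancel₀ hf0.ne']
  · rw [norm_smul, norm_div, norm_norm, div_mul_eq_mul_div, div_le_iff₀ hfx0]
    nlinarith [norm_nonneg x]
  · have : f x ≠ 0 := norm_pos_iff.1 hfx0
    simp only [_root_.smul_apply, map_smul, smul_eq_mul]
    field_simp

end FunctionalsOnQuotients

/-! ### Subspaces of finite codimension. -/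

section Codimension

variable {X : Type u} [NormedAddCommGroup X] [NormedSpace ℝ X]

theorem not_finiteDimensional_of_addFin_eq_top {Y : Subspaces X} {F : Submodule ℝ X}
    [FiniteDimensional ℝ F] (hYF : addFin Y F = ⊤)
    (hX : ¬ FiniteDimensional ℝ (⊤ : Subspaces X).toSubmodule) :
    ¬ FiniteDimensional ℝ Y.toSubmodule := by
  intro hY
  refine hX ?_
  rw [← hYF]
  exact Submodule.finiteDimensional_sup Y.toSubmodule F

end Codimension

/-! ### Degrees and large subspaces. -/

section DegreeLemmas

theorem ApproxPair.Hom.one_le_norm {P Q : ApproxPair.{u}} (φ : ApproxPair.Hom P Q) :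
    1 ≤ φ.norm := by
  unfold ApproxPair.Hom.norm
  split_ifs with h
  · exact le_rfl
  obtain ⟨g, hg, hg0⟩ := Submodule.exists_mem_ne_zero_of_ne_bot h
  have h1 := φ.comm ⟨g, hg⟩
  have h2 := φ.T.le_opNorm (φ.S ⟨g, hg⟩ : P.space)
  have h3 := φ.S.le_opNorm ⟨g, hg⟩
  rw [h1] at h2
  have hpos : 0 < ‖g‖ := norm_pos_iff.2 hg0
  have h4 : ‖g‖ ≤ ‖φ.T‖ * (‖φ.S‖ * ‖g‖) :=
    h2.trans (mul_le_mul_of_nonneg_left h3 (norm_nonneg _))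
  by_contra hlt
  push Not at hlt
  nlinarith

theorem ApproxPair.Hom.norm_le {P Q : ApproxPair.{u}} (φ : ApproxPair.Hom P Q) {C : ℝ}
    (hC : 1 ≤ C) (h : ‖φ.S‖ * ‖φ.T‖ ≤ C) : φ.norm ≤ C := by
  unfold ApproxPair.Hom.norm
  split_ifs
  exacts [hC, h]

/-- A control function bounds the degree along morphisms of bounded norm. -/
theorem IsDegree.exists_control {d : ApproxPair.{u} → ℝ≥0} (hd : IsDegree d) :
    ∃ K : ℝ → ℝ≥0 → ℝ≥0, (∀ t, Tendsto (fun s => K s t) (𝓝[>] 1) (𝓝 t)) ∧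
      ∀ (C : ℝ) (M : ℝ≥0) (P Q : ApproxPair.{u}) (φ : ApproxPair.Hom P Q), φ.norm ≤ C → d P ≤ M →
        d Q ≤ K C M := by
  obtain ⟨K, h1, h2, h3, h4⟩ := hd
  refine ⟨K, h3, fun C M P Q φ hC hM => (h4 P Q φ).trans ?_⟩
  exact (h2 _ φ.one_le_norm hM).trans
    (h1 M (show φ.norm ∈ Set.Ici 1 from φ.one_le_norm) (φ.one_le_norm.trans hC) hC)

/-- If `E` is finite-dimensional, inclusions `F → E` give morphisms of norm at most `1` from the
pair `(E, E)`, which bound all degrees `d (E, F)`. -/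
theorem IsLarge.not_finiteDimensional {d : ApproxPair.{u} → ℝ≥0} (hd : IsDegree d) {E : Type u}
    [NormedAddCommGroup E] [NormedSpace ℝ E] [CompleteSpace E] (hE : IsLarge d E) :
    ¬ FiniteDimensional ℝ E := by
  intro hfd
  obtain ⟨K, -, hK⟩ := hd.exists_control
  obtain ⟨F, hF, hlt⟩ := hE (K 1 (d ⟨E, ⊤⟩))
  refine hlt.not_ge ?_
  let φ : ApproxPair.Hom ⟨E, ⊤⟩ ⟨E, F⟩ :=
    { S := F.subtypeL.codRestrict ⊤ fun _ => trivial
      T := ContinuousLinearMap.id ℝ E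
      comm := fun _ => rfl }
  refine hK 1 _ _ _ φ (φ.norm_le le_rfl ?_) le_rfl
  have h1 : ‖φ.S‖ ≤ 1 := ContinuousLinearMap.opNorm_le_bound _ zero_le_one fun x => by
    rw [one_mul]; rfl
  exact mul_le_one₀ h1 (norm_nonneg _) ContinuousLinearMap.norm_id_le

/-- A bound `M` on the degrees of `Y` would give the bound `K C M` on those of `E`. -/
theorem IsLarge.of_hom {d : ApproxPair.{u} → ℝ≥0} (hd : IsDegree d) {E Y : Type u}
    [NormedAddCommGroup E] [NormedSpace ℝ E] [CompleteSpace E]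
    [NormedAddCommGroup Y] [NormedSpace ℝ Y] [CompleteSpace Y] (hE : IsLarge d E) {C : ℝ}
    (h : ∀ (G : Submodule ℝ E) [FiniteDimensional ℝ G], ∃ (G' : Submodule ℝ Y)
      (_ : FiniteDimensional ℝ G') (φ : ApproxPair.Hom ⟨Y, G'⟩ ⟨E, G⟩), φ.norm ≤ C) :
    IsLarge d Y := by
  obtain ⟨K, -, hK⟩ := hd.exists_control
  intro M
  obtain ⟨G, hG, hlt⟩ := hE (K C M)
  obtain ⟨G', hG', φ, hφ⟩ := h G
  refine ⟨G', hG', ?_⟩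
  by_contra hle
  exact hlt.not_ge (hK C M _ _ φ hφ (not_lt.1 hle))

/-- Largeness passes to an infinite-dimensional closed hyperplane `Y` of `E`. -/
theorem IsLarge.of_hyperplane {d : ApproxPair.{u} → ℝ≥0} (hd : IsDegree d) {E Y : Type u}
    [NormedAddCommGroup E] [NormedSpace ℝ E] [CompleteSpace E]
    [NormedAddCommGroup Y] [NormedSpace ℝ Y] [CompleteSpace Y] (hE : IsLarge d E)
    (hY : ¬ FiniteDimensional ℝ Y) (ι : Y →L[ℝ] E) (p : E →L[ℝ] Y) (f : E →L[ℝ] ℝ) (w : E)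
    (hsplit : ∀ x, ι (p x) + f x • w = x) : IsLarge d Y := by
  set a := ‖p‖ + ‖f‖ * 2
  set b := ‖ι‖ + (‖w‖ + ‖ι‖ * 2)
  have ha : 0 ≤ a := by positivity
  have hb : 0 ≤ b := by positivity
  refine hE.of_hom hd (C := max 1 (a * b)) fun G hG => ?_
  obtain ⟨g, z, hg, hz, hgz, hg0⟩ :=
    exists_functional_vanishing_on_finiteDimensional hY (G.map p.toLinearMap)
  -- The lost direction `w` is stored in a spare direction `z` of `Y`. As `g` vanishes on `p G` and
  -- `g z = 1`, it recovers the coefficient `f x`, and `T` replaces `ι z` by `w`.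
  let S : E →L[ℝ] Y := p + f.smulRight z
  let T : Y →L[ℝ] E := ι + g.smulRight (w - ι z)
  have hTS : ∀ x ∈ G, T (S x) = x := by
    intro x hx
    have h1 : g (p x) = 0 := hg0 _ ⟨x, hx, rfl⟩
    have h2 : g (S x) = f x := by simp [S, h1, hgz]
    have h3 : T (S x) = ι (p x) + f x • ι z + f x • (w - ι z) := by
      simp only [T, _root_.add_apply, ContinuousLinearMap.smulRight_apply, h2]
      simp [S]
    rw [h3, smul_sub, add_assoc, add_sub_cancel, hsplit]
  refine ⟨G.map S.toLinearMap, inferInstance,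
    { S := (S.comp G.subtypeL).codRestrict _ fun x => ⟨x, x.2, rfl⟩
      T := T
      comm := fun x => hTS x x.2 }, ?_⟩
  · refine ApproxPair.Hom.norm_le _ (le_max_left _ _) (le_trans ?_ (le_max_right _ _))
    refine mul_le_mul ?_ ?_ (norm_nonneg _) ha
    · refine ContinuousLinearMap.opNorm_le_bound _ ha fun x => ?_
      have h1 : ‖S‖ ≤ a := by
        refine (norm_add_le _ _).trans (add_le_add le_rfl ?_)
        rw [ContinuousLinearMap.norm_smulRight_apply]
        exact mul_le_mul_of_nonneg_left hz (norm_nonneg _)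
      exact (S.le_opNorm x).trans (mul_le_mul_of_nonneg_right h1 (norm_nonneg _))
    · refine (norm_add_le _ _).trans (add_le_add le_rfl ?_)
      rw [ContinuousLinearMap.norm_smulRight_apply]
      have h2 : ‖w - ι z‖ ≤ ‖w‖ + ‖ι‖ * 2 :=
        (norm_sub_le _ _).trans (add_le_add le_rfl
          ((ι.le_opNorm z).trans (mul_le_mul_of_nonneg_left hz (norm_nonneg _))))
      exact (mul_le_mul hg h2 (norm_nonneg _) zero_le_one).trans_eq (one_mul _)

variable {X : Type u} [NormedAddCommGroup X] [NormedSpace ℝ X] [CompleteSpace X]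

theorem mem_largeFamily_of_sup_span_singleton {d : ApproxPair.{u} → ℝ≥0} (hd : IsDegree d)
    {Y W : Subspaces X} (hY : ¬ FiniteDimensional ℝ Y.toSubmodule) {w : X}
    (hW : W.toSubmodule = Y.toSubmodule ⊔ Submodule.span ℝ {w}) (hL : W ∈ largeFamily X d) :
    Y ∈ largeFamily X d := by
  by_cases hw : w ∈ Y
  · have : W = Y := by
      refine ClosedSubmodule.toSubmodule_injective ?_
      rw [hW, sup_eq_left, Submodule.span_singleton_le_iff_mem]
      exact hw
    rwa [← this]
  obtain ⟨f, hf, hfw⟩ := exists_functional_eq_one Y.isClosed (S := Y.toSubmodule) hw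
  have hYW : Y.toSubmodule ≤ W.toSubmodule := hW ▸ le_sup_left
  have hwW : w ∈ W.toSubmodule := by
    rw [hW]; exact Submodule.mem_sup_right (Submodule.mem_span_singleton_self w)
  have hmem : ∀ x ∈ W.toSubmodule, x - f x • w ∈ Y.toSubmodule := by
    intro x hx
    rw [hW, Submodule.mem_sup] at hx
    obtain ⟨y, hy, v, hv, rfl⟩ := hx
    obtain ⟨c, rfl⟩ := Submodule.mem_span_singleton.1 hv
    simpa [hf y hy, hfw] using hy
  have : CompleteSpace Y.toSubmodule := Y.isClosed.completeSpace_coe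
  have : CompleteSpace W.toSubmodule := W.isClosed.completeSpace_coe
  have hL' : IsLarge d W.toSubmodule := hL
  let p : W.toSubmodule →L[ℝ] Y.toSubmodule :=
    ((ContinuousLinearMap.id ℝ X - f.smulRight w).comp W.toSubmodule.subtypeL).codRestrict
      Y.toSubmodule fun x => hmem x x.2
  let ι : Y.toSubmodule →L[ℝ] W.toSubmodule :=
    Y.toSubmodule.subtypeL.codRestrict W.toSubmodule fun y => hYW y.2
  refine hL'.of_hyperplane hd hY ι p (f.comp W.toSubmodule.subtypeL) ⟨w, hwW⟩ fun x => ?_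
  refine Subtype.ext ?_
  change ((x : X) - f x • w) + f x • w = x
  exact sub_add_cancel _ _

/-- Spanning vectors of `F` are removed one at a time, each removal being the hyperplane case. -/
theorem mem_largeFamily_of_sup_finiteDimensional {d : ApproxPair.{u} → ℝ≥0} (hd : IsDegree d)
    {Y W : Subspaces X} (hY : ¬ FiniteDimensional ℝ Y.toSubmodule) (F : Submodule ℝ X)
    [FiniteDimensional ℝ F] (hW : W.toSubmodule = Y.toSubmodule ⊔ F)
    (hL : W ∈ largeFamily X d) : Y ∈ largeFamily X d := by
  classical
  obtain ⟨s, rfl⟩ := (Submodule.fg_iff_finiteDimensional F).2 ‹_›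
  induction s using Finset.induction_on generalizing W with
  | empty =>
    have : W = Y := ClosedSubmodule.toSubmodule_injective (by simpa using hW)
    rwa [← this]
  | insert w s _ ih =>
    have : FiniteDimensional ℝ (Submodule.span ℝ (s : Set X)) :=
      FiniteDimensional.span_finset ℝ s
    refine ih (W := addFin Y (Submodule.span ℝ (s : Set X)))
      (mem_largeFamily_of_sup_span_singleton hd (W := W) (w := w) ?_ ?_ hL) rfl
    · intro hfd
      exact hY (Submodule.finiteDimensional_of_le
        (show Y.toSubmodule ≤ (addFin Y (Submodule.span ℝ (s : Set X))).toSubmodule from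
          le_sup_left))
    · change W.toSubmodule = (Y.toSubmodule ⊔ Submodule.span ℝ (s : Set X)) ⊔ _
      rw [hW, Finset.coe_insert, Submodule.span_insert, sup_assoc, sup_comm (Submodule.span ℝ {w})]

/-- The degree of a finite-dimensional subspace is almost preserved by almost-identical
isomorphisms. -/
theorem exists_hom_of_close {Y Z' Z : Subspaces X} (hZ'Y : Z' ≤ Y) {F : Submodule ℝ Y.toSubmodule}
    [FiniteDimensional ℝ F] (hF : F.map Y.toSubmodule.subtype ≤ Z'.toSubmodule) {ε : ℝ} (hε : 0 < ε)
    (hε1 : ε < 1) (T : Z'.toSubmodule ≃L[ℝ] Z.toSubmodule)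
    (hT : ‖Z.toSubmodule.subtypeL.comp (T : Z'.toSubmodule →L[ℝ] Z.toSubmodule)
        - Z'.toSubmodule.subtypeL‖ < ε) :
    haveI : CompleteSpace Y.toSubmodule := Y.isClosed.completeSpace_coe
    haveI : CompleteSpace Z.toSubmodule := Z.isClosed.completeSpace_coe
    ∃ (F' : Submodule ℝ Z.toSubmodule) (_ : FiniteDimensional ℝ F')
      (φ : ApproxPair.Hom ⟨Z.toSubmodule, F'⟩ ⟨Y.toSubmodule, F⟩),
      φ.norm ≤ (1 + ε) / (1 - ε) := by
  have hdist : ∀ x : Z'.toSubmodule, ‖(T x : X) - x‖ ≤ ε * ‖x‖ := fun x =>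
    (ContinuousLinearMap.le_of_opNorm_le _ hT.le x)
  have hup : ∀ x : Z'.toSubmodule, ‖T x‖ ≤ (1 + ε) * ‖x‖ := by
    intro x
    have h1 : ‖(T x : X)‖ ≤ ‖(T x : X) - x‖ + ‖(x : X)‖ := by
      simpa using norm_add_le ((T x : X) - x) (x : X)
    have h2 := hdist x
    change ‖(T x : X)‖ ≤ (1 + ε) * ‖(x : X)‖
    change _ ≤ ε * ‖(x : X)‖ at h2
    linarith
  have hlow : ∀ x : Z'.toSubmodule, (1 - ε) * ‖x‖ ≤ ‖T x‖ := by
    intro x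
    have h1 : ‖(x : X)‖ ≤ ‖(T x : X)‖ + ‖(T x : X) - x‖ := by
      simpa using norm_sub_le (T x : X) ((T x : X) - x)
    have h2 := hdist x
    change (1 - ε) * ‖(x : X)‖ ≤ ‖(T x : X)‖
    change _ ≤ ε * ‖(x : X)‖ at h2
    linarith
  have hε' : 0 < 1 - ε := by linarith
  let j : F →L[ℝ] Z'.toSubmodule :=
    (Y.toSubmodule.subtypeL.comp F.subtypeL).codRestrict Z'.toSubmodule fun x => hF ⟨x, x.2, rfl⟩
  let S₀ : F →L[ℝ] Z.toSubmodule := (T : Z'.toSubmodule →L[ℝ] Z.toSubmodule).comp j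
  let i : Z'.toSubmodule →L[ℝ] Y.toSubmodule :=
    Z'.toSubmodule.subtypeL.codRestrict Y.toSubmodule fun x => hZ'Y x.2
  let R : Z.toSubmodule →L[ℝ] Y.toSubmodule :=
    i.comp (T.symm : Z.toSubmodule →L[ℝ] Z'.toSubmodule)
  refine ⟨LinearMap.range S₀.toLinearMap, inferInstance,
    { S := S₀.codRestrict _ fun x => ⟨x, rfl⟩
      T := R
      comm := fun x => ?_ }, ?_⟩
  · change i (T.symm (T (j x))) = x
    rw [T.symm_apply_apply]
    rfl
  · refine ApproxPair.Hom.norm_le _ ((one_le_div hε').2 (by linarith)) ?_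
    rw [div_eq_mul_inv]
    refine mul_le_mul ?_ ?_ (norm_nonneg _) (by linarith)
    · exact ContinuousLinearMap.opNorm_le_bound _ (by linarith) fun x => hup (j x)
    · refine ContinuousLinearMap.opNorm_le_bound _ (inv_nonneg.2 hε'.le) fun z => ?_
      have h := hlow (T.symm z)
      rw [T.apply_symm_apply] at h
      rw [inv_mul_eq_div, le_div_iff₀ hε', mul_comm]
      exact h

theorem isGδ_largeFamily {d : ApproxPair.{u} → ℝ≥0} (hd : IsDegree d) :
    @IsGδ (Subspaces X) (ellentuckTopology X) (largeFamily X d) := by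
  obtain ⟨K, hKlim, hK⟩ := hd.exists_control
  let U : ℕ → Set (Subspaces X) := fun n => {Y |
    haveI : CompleteSpace Y.toSubmodule := Y.isClosed.completeSpace_coe
    ∃ (F : Submodule ℝ Y.toSubmodule) (_ : FiniteDimensional ℝ F),
      (n : ℝ≥0) < d ⟨Y.toSubmodule, F⟩}
  have hU : largeFamily X d = ⋂ n, U n := by
    ext Y
    simp only [Set.mem_iInter]
    constructor
    · exact fun h n => h n
    · intro h M
      obtain ⟨n, hn⟩ := exists_nat_ge M
      obtain ⟨F, hF, hlt⟩ := h n
      exact ⟨F, hF, hn.trans_lt hlt⟩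
  rw [hU]
  let _ := ellentuckTopology X
  refine IsGδ.iInter_of_isOpen fun n => ?_
  rw [isOpen_iff_forall_mem_open]
  rintro Y ⟨F, hF, hlt⟩
  have hev : ∀ᶠ s in 𝓝[>] (1 : ℝ), K s n < d _ := (hKlim n).eventually (gt_mem_nhds hlt)
  obtain ⟨s, hs, hs1⟩ := (hev.and self_mem_nhdsWithin).exists
  have hs1' : 1 < s := hs1
  -- The solution of `(1 + ε) / (1 - ε) = s`.
  set ε := (s - 1) / (s + 1) with hε
  have hε0 : 0 < ε := div_pos (by linarith) (by linarith)
  have hε1 : ε < 1 := by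
    rw [hε, div_lt_one (by linarith)]
    linarith
  have hεs : (1 + ε) / (1 - ε) = s := by
    have h1 : s + 1 ≠ 0 := by linarith
    rw [div_eq_iff (by linarith), hε]
    field_simp
    ring
  have hFY : F.map Y.toSubmodule.subtype ≤ Y.toSubmodule := by
    rintro _ ⟨y, -, rfl⟩
    exact y.2
  refine ⟨ellentuckBasic (F.map Y.toSubmodule.subtype) Y ε, ?_,
    TopologicalSpace.isOpen_generateFrom_of_mem ⟨_, Y, ε, inferInstance, hFY, hε0, rfl⟩, ?_⟩
  · rintro Z ⟨Z', hFZ', hZ'Y, T, hT⟩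
    obtain ⟨F', hF', φ, hφ⟩ := exists_hom_of_close hZ'Y hFZ' hε0 hε1 T hT
    refine ⟨F', hF', ?_⟩
    by_contra hle
    exact (hK s n _ _ φ (hφ.trans_eq hεs) (not_lt.1 hle)).not_gt hs
  · refine ⟨Y, hFY, le_rfl, ContinuousLinearEquiv.refl ℝ _, ?_⟩
    refine (ContinuousLinearMap.opNorm_le_bound _ le_rfl fun x => ?_).trans_lt hε0
    simp

end DegreeLemmas

theorem theorem5p10 (X : Type u) [NormedAddCommGroup X] [NormedSpace ℝ X] [CompleteSpace X] :
    (∀ H : Set (Subspaces X), IsDFamily H → IsTightSpace X H → IsoInvariant H → IsErgodicSpace X) ∧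
    (∀ d : ApproxPair.{u} → ℝ≥0, IsDegree d → IsDegreeTight X d → IsErgodicSpace X) := by
  constructor
  · intro H hD ht _
    refine isErgodicSpace_of_isGδ hD.isGδ (fun Y F _ hYF => ?_) ht
    rw [hD.add_mem_iff Y (not_finiteDimensional_of_addFin_eq_top hYF (hD.infinite _ ht.1)) F, hYF]
    exact ht.1
  · intro d hd ht
    refine isErgodicSpace_of_isGδ (isGδ_largeFamily hd) (fun Y F _ hYF => ?_) ht
    have : CompleteSpace (⊤ : Subspaces X).toSubmodule :=
      (⊤ : Subspaces X).isClosed.completeSpace_coe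
    have hX : IsLarge d (⊤ : Subspaces X).toSubmodule := ht.1
    exact mem_largeFamily_of_sup_finiteDimensional hd
      (not_finiteDimensional_of_addFin_eq_top hYF (hX.not_finiteDimensional hd)) F
      (congrArg ClosedSubmodule.toSubmodule hYF).symm ht.1
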